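/- Consider $x_{k+1}=Ax_k+w_k$, $y_k=Cx_k+v_k$ ($k\in\mathbb N$), with $x_k\in\mathbb R^n$, $y_k\in\mathbb R^m$, where $x_0\sim\mathcal N(0,\Pi_0)$, $w_k\sim\mathcal N(0,Q)$, $v_k\sim\mathcal N(0,R)$ are mutually independent, $\Pi_0\succeq0$, $Q\succeq0$, $R\succ0$. Let $\hat x^s_k=\mathbb E[x_k\mid y_1,\dots,y_k]$ be the sensor's local estimate, and assume that the local Kalman filter is in steady state: there is a constant matrix $\overline P$ such that, for all $k\ge 0$, $\mathbb E[(x_k-\hat x^s_k)(x_k-\hat x^s_k)'\mid y_1,\dots,y_k]=\overline P$ almost surely. Let $\gamma_0=1$ and, for $k\ge1$, let $\gamma_k\in\{0,1\}$ indicate whether $\hat x_k^s$ arrives at the remote estimator at time $k$. Put $\mathrm I_k=\sigma(\gamma_1\hat x^s_1,\dots,\gamma_k\hat x^s_k,\gamma_1,\dots,\gamma_k)$, let $\tau(k)=k-\max\{t: 0\le t\le k-1,\ \gamma_t=1\}$ be the holding time, and let $\varepsilon_k=\hat x_k^s-A^{\tau(k)}\hat x^s_{k-\tau(k)}$. The controller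 $\theta_{\rm ef}$ uses at time $k\ge 1$ the transmission power $$\omega_k=\frac{N_0W}{2\alpha}\,\varepsilon_k'\mathcal Q_{\tau(k)}\varepsilon_k+\omega ,$$ where $N_0,W>0$, $\alpha\in(0,1]$, $\omega\ge0$ and the $\mathcal Q_\tau\succeq0$ ($\tau\ge1$) are constants. For each $k\ge1$, given $x_0$, $(w_j)_{j\ge0}$, $(v_j)_{j\ge0}$ and $\gamma_1,\dots,\gamma_{k-1}$, the conditional probability that $\gamma_k=0$ is $q^{\omega_k}$, where $q=\exp(-\alpha/(N_0W))$. Let $h(X)=AXA'+Q$, $\Psi_0=0$ and, for $\tau\ge1$, $$\Sigma_\tau=A\Psi_{\tau-1}A'+\big(h(\overline P)-\overline P\big),\qquad \Psi_\tau=\big(\mathcal Q_\tau+\Sigma_\tau^{-1}\big)^{-1},$$ where $^{-1}$ denotes the Moore-Penrose pseudoinverse, and assume that $\Sigma_\tau\succeq\Psi_\tau$ for all $\tau\ge1$. Let $\hat x_k=\mathbb E[x_k\mid \mathrm I_k]$ and $P_k=\mathbb E[(x_k-\hat x_k)(x_k-\hat x_k)'\mid \mathrm I_k]$ be the remote estimator's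 MMSE estimate and its error covariance. Then for every $k\ge1$, almost surely, $$P_k=\begin{cases}\overline P, & \text{if }\gamma_k=1,\\ \overline P+\Psi_{\tau(k)}, & \text{if }\gamma_k=0.\end{cases}$$ -/

import Mathlib

open MeasureTheory ProbabilityTheory
open scoped Matrix

namespace RemoteEstimation

noncomputable section

/-- The Moore-Penrose pseudoinverse of a real symmetric matrix: in a spectral decomposition
`S = U diag(d) Uᵀ` every nonzero eigenvalue is inverted and the zero eigenvalues stay zero (in Lean,
`0⁻¹ = 0`). It satisfies the Penrose conditions, see `isMoorePenroseInverse_pinv`.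
It is only used for symmetric matrices; the value at other matrices is irrelevant. -/
def pinv {n : ℕ} (S : Matrix (Fin n) (Fin n) ℝ) : Matrix (Fin n) (Fin n) ℝ :=
  open Classical in
  if hS : S.IsHermitian then
    (hS.eigenvectorUnitary : Matrix (Fin n) (Fin n) ℝ) *
      Matrix.diagonal (fun i => (hS.eigenvalues i)⁻¹) *
      star (hS.eigenvectorUnitary : Matrix (Fin n) (Fin n) ℝ)
  else 0

/-- The four Penrose conditions, which characterise the Moore-Penrose pseudoinverse `B` of `S`. -/
structure IsMoorePenroseInverse {n : ℕ} (S B : Matrix (Fin n) (Fin n) ℝ) : Prop where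
  mul_mul_self : S * B * S = S
  mul_mul_inv : B * S * B = B
  symm_left : (S * B)ᵀ = S * B
  symm_right : (B * S)ᵀ = B * S

theorem isMoorePenroseInverse_pinv {n : ℕ} {S : Matrix (Fin n) (Fin n) ℝ} (hS : S.IsHermitian) :
    IsMoorePenroseInverse S (pinv S) := by
  set U : Matrix (Fin n) (Fin n) ℝ := (hS.eigenvectorUnitary : Matrix (Fin n) (Fin n) ℝ) with hU
  set d := hS.eigenvalues with hd
  have hUU : star U * U = 1 := Unitary.coe_star_mul_self hS.eigenvectorUnitary
  have hSd : S = U * Matrix.diagonal d * star U := by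
    have h := hS.spectral_theorem
    rw [Unitary.conjStarAlgAut_apply] at h
    exact h
  have hBd : pinv S = U * Matrix.diagonal (fun i => (d i)⁻¹) * star U := by
    simp only [pinv, dif_pos hS, hU, hd]
  have key : ∀ a b : Fin n → ℝ, U * Matrix.diagonal a * star U * (U * Matrix.diagonal b * star U)
      = U * Matrix.diagonal (fun i => a i * b i) * star U := by
    intro a b
    calc U * Matrix.diagonal a * star U * (U * Matrix.diagonal b * star U)
        = U * Matrix.diagonal a * (star U * U) * Matrix.diagonal b * star U := by
          simp only [Matrix.mul_assoc]
      _ = U * Matrix.diagonal (fun i => a i * b i) * star U := by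
          rw [hUU, Matrix.mul_one, Matrix.mul_assoc U, Matrix.diagonal_mul_diagonal]
  have symm : ∀ a : Fin n → ℝ, (U * Matrix.diagonal a * star U)ᵀ
      = U * Matrix.diagonal a * star U := by
    intro a
    simp [Matrix.star_eq_conjTranspose, Matrix.transpose_mul, Matrix.mul_assoc]
  refine ⟨?_, ?_, ?_, ?_⟩
  · rw [hBd]; conv_lhs => rw [hSd]
    conv_rhs => rw [hSd]
    rw [key, key]
    congr 3; funext i
    by_cases h : d i = 0 <;> simp [h]
  · rw [hBd]; conv_lhs => rw [hSd]
    rw [key, key]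
    congr 3; funext i
    by_cases h : d i = 0 <;> simp [h]
  · rw [hBd]; conv => rw [hSd]
    rw [key, symm]
  · rw [hBd]; conv => rw [hSd]
    rw [key, symm]

/-- The one-step prediction map `h(X) = A X Aᵀ + Q` of error covariances. -/
def predCov {n : ℕ} (A Q X : Matrix (Fin n) (Fin n) ℝ) : Matrix (Fin n) (Fin n) ℝ :=
  A * X * Aᵀ + Q

/-- `Ψ_0 = 0` and `Ψ_τ = (𝒬_τ + Σ_τ⁻¹)⁻¹` for `τ ≥ 1`, where
`Σ_τ = A Ψ_{τ-1} Aᵀ + (h(P̄) - P̄)` and the inverses are Moore-Penrose pseudoinverses. -/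
def Psi {n : ℕ} (A Q Pbar : Matrix (Fin n) (Fin n) ℝ) (wt : ℕ → Matrix (Fin n) (Fin n) ℝ) :
    ℕ → Matrix (Fin n) (Fin n) ℝ
  | 0 => 0
  | τ + 1 => pinv (wt (τ + 1) +
      pinv (A * Psi A Q Pbar wt τ * Aᵀ + (predCov A Q Pbar - Pbar)))

/-- `Σ_τ = A Ψ_{τ-1} Aᵀ + (h(P̄) - P̄)`, for `τ ≥ 1`. -/
def Sig {n : ℕ} (A Q Pbar : Matrix (Fin n) (Fin n) ℝ) (wt : ℕ → Matrix (Fin n) (Fin n) ℝ)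
    (τ : ℕ) : Matrix (Fin n) (Fin n) ℝ :=
  A * Psi A Q Pbar wt (τ - 1) * Aᵀ + (predCov A Q Pbar - Pbar)

variable {Ω : Type*} [MeasurableSpace Ω]

/-- The conditional error covariance matrix `E[(X - E[X|𝓕])(X - E[X|𝓕])ᵀ | 𝓕]` of a random vector
given a sub-σ-algebra `𝓕`, a random matrix. -/
def errCov {n : ℕ} (μ : Measure Ω) (X : Ω → EuclideanSpace ℝ (Fin n)) (𝓕 : MeasurableSpace Ω)
    (s : Ω) : Matrix (Fin n) (Fin n) ℝ :=
  Matrix.of fun i j =>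
    (μ[fun s' => (X s' i - (μ[X | 𝓕]) s' i) * (X s' j - (μ[X | 𝓕]) s' j) | 𝓕]) s

/-- The σ-algebra generated by the measurements `y_1, …, y_k`. -/
@[reducible] def sensorInfo {m : ℕ} (y : ℕ → Ω → EuclideanSpace ℝ (Fin m)) (k : ℕ) : MeasurableSpace Ω :=
  ⨆ j ∈ Finset.Icc 1 k, MeasurableSpace.comap (y j) inferInstance

/-- The sensor's local MMSE estimate `x̂ˢ_k = E[x_k | y_1, …, y_k]`. -/
def localEst {n m : ℕ} (μ : Measure Ω) (x : ℕ → Ω → EuclideanSpace ℝ (Fin n))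
    (y : ℕ → Ω → EuclideanSpace ℝ (Fin m)) (k : ℕ) : Ω → EuclideanSpace ℝ (Fin n) :=
  μ[x k | sensorInfo y k]

/-- The σ-algebra `I_k` of the information at the remote estimator, generated by
`γ_1 x̂ˢ_1, …, γ_k x̂ˢ_k` and `γ_1, …, γ_k`. Here `xs j` stands for `x̂ˢ_j`. -/
@[reducible] def remoteInfo {n : ℕ} (γ : ℕ → Ω → ℕ) (xs : ℕ → Ω → EuclideanSpace ℝ (Fin n)) (k : ℕ) :
    MeasurableSpace Ω :=
  ⨆ j ∈ Finset.Icc 1 k,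
    MeasurableSpace.comap (fun s => γ j s • xs j s) inferInstance ⊔
      MeasurableSpace.comap (γ j) inferInstance

/-- The holding time `τ(k) = k - max {t : 0 ≤ t ≤ k - 1, γ_t = 1}` (with `γ_0 = 1`). -/
def holdTime (γ : ℕ → Ω → ℕ) (k : ℕ) (s : Ω) : ℕ :=
  k - Nat.findGreatest (fun t => γ t s = 1) (k - 1)

/-- The incremental innovation `ε_k = x̂ˢ_k - A^{τ(k)} x̂ˢ_{k-τ(k)}`. -/
def incInnov {n : ℕ} (A : Matrix (Fin n) (Fin n) ℝ) (γ : ℕ → Ω → ℕ)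
    (xs : ℕ → Ω → EuclideanSpace ℝ (Fin n)) (k : ℕ) (s : Ω) : EuclideanSpace ℝ (Fin n) :=
  xs k s - Matrix.toEuclideanLin (A ^ holdTime γ k s) (xs (k - holdTime γ k s) s)

/-- The transmission power `ω_k = (N₀ W / (2 α)) ε_kᵀ 𝒬_{τ(k)} ε_k + ω` of the data-driven
controller `θ_ef` with weights `wt τ = 𝒬_τ` and constant term `base = ω`. -/
def power {n : ℕ} (N₀ W α base : ℝ) (wt : ℕ → Matrix (Fin n) (Fin n) ℝ)
    (A : Matrix (Fin n) (Fin n) ℝ) (γ : ℕ → Ω → ℕ)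
    (xs : ℕ → Ω → EuclideanSpace ℝ (Fin n)) (k : ℕ) (s : Ω) : ℝ :=
  N₀ * W / (2 * α) *
    ((incInnov A γ xs k s).ofLp ⬝ᵥ (wt (holdTime γ k s) *ᵥ (incInnov A γ xs k s).ofLp)) + base

/-- The σ-algebra of everything that precedes the channel use at time `k`, together with the entire
plant randomness: generated by `x_0`, all `w_j`, all `v_j`, and `γ_1, …, γ_{k-1}`. -/
@[reducible] def plantAndPast {n m : ℕ} (x₀ : Ω → EuclideanSpace ℝ (Fin n))
    (w : ℕ → Ω → EuclideanSpace ℝ (Fin n)) (v : ℕ → Ω → EuclideanSpace ℝ (Fin m))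
    (γ : ℕ → Ω → ℕ) (k : ℕ) : MeasurableSpace Ω :=
  MeasurableSpace.comap x₀ inferInstance ⊔
    (⨆ j, MeasurableSpace.comap (w j) inferInstance) ⊔
    (⨆ j, MeasurableSpace.comap (v j) inferInstance) ⊔
    (⨆ j ∈ Finset.Icc 1 (k - 1), MeasurableSpace.comap (γ j) inferInstance)

end

end RemoteEstimation

open MeasureTheory ProbabilityTheory
open scoped Matrix

/-! ### Pseudoinverses and the singular form of `(W + S⁻¹)⁻¹`. -/

namespace RemoteEstimation

/-! Let a packet arrive at time `t`, let the next `i` be dropped, and put `k = t + i`. The remote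
error then splits as `x_k - A^i x̂ˢ_t = (x_k - x̂ˢ_k) + (x̂ˢ_k - A^i x̂ˢ_t)`. The first summand is
the local filtering error, of law `N(0, P̄)` and independent of the measurements
(`IsSteadyPlant.filter_error`). Given the measurements, the drops reveal nothing more about the
plant (`condExp_sensorInfo_sup_channelInfo`), so this error is independent of the channel outcomes
as well.

The second summand is Gaussian with covariance `Ψ_i` on the event considered, by induction on `i`
(`exists_map_restrict_innovation`). Passing to the next time applies `A` and adds a fresh innovation
of law `N(0, h(P̄) - P̄)`, which turns `Ψ_i` into `Σ_{i+1}`. A drop has conditional probability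
proportional to `exp(-εᵀ𝒬ε/2)`, so restricting to it multiplies the law by a Gaussian weight, and
`N(0, Σ)` becomes a multiple of `N(0, (𝒬 + Σ⁻¹)⁻¹)` (`exists_multivariateGaussian_withDensity`). For
singular `Σ` this uses `Σ ⪰ Ψ`, which forces `ker Σ ⊆ ker 𝒬`.

Regular conditional laws are avoided: the induction concerns unnormalised laws on `B ∩ dropEvent γ t
i`, for any event `B` known at time `t` on which a packet arrives then. The choice of `B` affects
only a scalar factor. Since every message after `t` is zero on the drop event, the remote
information there is no finer than what is known at time `t`. Hence the first two moments over these
sets determine the conditional mean and the error covariance (`errCov_eq_on_of_setIntegral_eq`). -/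

theorem IsMoorePenroseInverse.unique {n : ℕ} {S B B' : Matrix (Fin n) (Fin n) ℝ}
    (h : IsMoorePenroseInverse S B) (h' : IsMoorePenroseInverse S B') : B = B' := by
  have h1 : B * S = B' * S := by
    calc B * S = (B * S)ᵀ := h.symm_right.symm
      _ = (B * (S * B' * S))ᵀ := by rw [h'.mul_mul_self]
      _ = (B' * S)ᵀ * (B * S)ᵀ := by rw [← Matrix.transpose_mul]; simp only [Matrix.mul_assoc]
      _ = B' * (S * B * S) := by rw [h.symm_right, h'.symm_right]; simp only [Matrix.mul_assoc]
      _ = B' * S := by rw [h.mul_mul_self]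
  have h2 : S * B = S * B' := by
    calc S * B = (S * B)ᵀ := h.symm_left.symm
      _ = ((S * B' * S) * B)ᵀ := by rw [h'.mul_mul_self]
      _ = (S * B)ᵀ * (S * B')ᵀ := by rw [← Matrix.transpose_mul]; simp only [Matrix.mul_assoc]
      _ = (S * B * S) * B' := by rw [h.symm_left, h'.symm_left]; simp only [Matrix.mul_assoc]
      _ = S * B' := by rw [h.mul_mul_self]
  calc B = B * S * B := h.mul_mul_inv.symm
    _ = B' * (S * B) := by rw [h1, Matrix.mul_assoc]
    _ = B' := by rw [h2, ← Matrix.mul_assoc, h'.mul_mul_inv]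

theorem posSemidef_pinv {n : ℕ} {S : Matrix (Fin n) (Fin n) ℝ} (hS : S.PosSemidef) :
    (pinv S).PosSemidef := by
  have hSH := hS.isHermitian
  have h : (Matrix.diagonal (fun i => (hSH.eigenvalues i)⁻¹)).PosSemidef :=
    Matrix.PosSemidef.diagonal fun i => inv_nonneg.2 (hS.eigenvalues_nonneg i)
  have := h.mul_mul_conjTranspose_same (hSH.eigenvectorUnitary : Matrix (Fin n) (Fin n) ℝ)
  simpa only [pinv, dif_pos hSH, Matrix.star_eq_conjTranspose] using this

theorem mul_pinv_comm {n : ℕ} {S : Matrix (Fin n) (Fin n) ℝ} (hS : S.PosSemidef) :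
    S * pinv S = pinv S * S := by
  have h := isMoorePenroseInverse_pinv hS.isHermitian
  have h1 : (pinv S)ᵀ = pinv S := by simpa using (posSemidef_pinv hS).isHermitian.eq
  have h2 : Sᵀ = S := by simpa using hS.isHermitian.eq
  rw [← h.symm_left, Matrix.transpose_mul, h1, h2]

/-- Here `0 ≤ uᵀTu ≤ uᵀSu = 0`, and a positive semidefinite form vanishes only on its kernel. -/
theorem mulVec_eq_zero_of_posSemidef_sub {n : ℕ} {S T : Matrix (Fin n) (Fin n) ℝ}
    (hT : T.PosSemidef) (hST : (S - T).PosSemidef) {u : Fin n → ℝ} (hu : S *ᵥ u = 0) :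
    T *ᵥ u = 0 := by
  have h1 := hST.dotProduct_mulVec_nonneg u
  have h2 := hT.dotProduct_mulVec_nonneg u
  rw [Matrix.sub_mulVec, hu, zero_sub, dotProduct_neg] at h1
  exact (hT.dotProduct_mulVec_zero_iff u).1 (by linarith)

/-- The only use of the order hypothesis `Σ ⪰ Ψ`. A vector killed by `S` is killed by the smaller
`pinv (W + pinv S)`, hence by `W + pinv S`, which has the same kernel, hence by `W`. So `W` lives on
the range of `S`. -/
theorem mul_mul_pinv_of_posSemidef_sub {n : ℕ} {S W : Matrix (Fin n) (Fin n) ℝ}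
    (hS : S.PosSemidef) (hW : W.PosSemidef) (h : (S - pinv (W + pinv S)).PosSemidef) :
    W * (S * pinv S) = W := by
  have hT : (W + pinv S).PosSemidef := hW.add (posSemidef_pinv hS)
  have key : ∀ u : Fin n → ℝ, S *ᵥ u = 0 → W *ᵥ u = 0 := by
    intro u hu
    have h1 := mulVec_eq_zero_of_posSemidef_sub (posSemidef_pinv hT) h hu
    have h2 : (W + pinv S) *ᵥ u = 0 := by
      rw [← (isMoorePenroseInverse_pinv hT.isHermitian).mul_mul_self, Matrix.mul_assoc,
        ← mul_pinv_comm hT, ← Matrix.mul_assoc, ← Matrix.mulVec_mulVec, h1, Matrix.mulVec_zero]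
    exact mulVec_eq_zero_of_posSemidef_sub hW (by simpa using posSemidef_pinv hS) h2
  have h3 : W * (1 - S * pinv S) = 0 := by
    rw [← Matrix.toLin'.map_eq_zero_iff]
    refine LinearMap.ext fun z => ?_
    rw [Matrix.toLin'_apply, ← Matrix.mulVec_mulVec, LinearMap.zero_apply]
    apply key
    rw [Matrix.mulVec_mulVec, Matrix.mul_sub, Matrix.mul_one, mul_pinv_comm hS,
      ← Matrix.mul_assoc, (isMoorePenroseInverse_pinv hS.isHermitian).mul_mul_self, sub_self,
      Matrix.zero_mulVec]
  rw [Matrix.mul_sub, Matrix.mul_one, sub_eq_zero] at h3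
  exact h3.symm

/-- A symmetric-looking form of `(W + S⁻¹)⁻¹` in terms of a symmetric square root `H` of `S`. -/
theorem pinv_add_pinv_eq {n : ℕ} {S W H : Matrix (Fin n) (Fin n) ℝ}
    (hW : W.PosSemidef) (hH : H.PosSemidef) (hHS : H * H = S)
    (h : (S - pinv (W + pinv S)).PosSemidef) :
    pinv (W + pinv S) = H * (1 + H * W * H)⁻¹ * H := by
  have hHt : Hᵀ = H := by simpa using hH.isHermitian.eq
  have hS : S.PosSemidef := by
    have := Matrix.posSemidef_conjTranspose_mul_self H
    rwa [hH.isHermitian.eq, hHS] at this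
  have hM : (H * W * H).PosSemidef := by
    have := hW.mul_mul_conjTranspose_same H
    rwa [hH.isHermitian.eq] at this
  have hN : (1 + H * W * H).PosDef := Matrix.PosDef.one.add_posSemidef hM
  set N := 1 + H * W * H with hNdef
  have hNu : IsUnit N.det := (Matrix.isUnit_iff_isUnit_det _).1 hN.isUnit
  have hNN : N⁻¹ * N = 1 := Matrix.nonsing_inv_mul _ hNu
  have hNN' : N * N⁻¹ = 1 := Matrix.mul_nonsing_inv _ hNu
  have hNt : (N⁻¹)ᵀ = N⁻¹ := by simpa using hN.inv.isHermitian.eq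
  set T := H * N⁻¹ * H with hT
  have hTt : Tᵀ = T := by
    rw [hT, Matrix.transpose_mul, Matrix.transpose_mul, hHt, hNt, Matrix.mul_assoc]
  have hpS := isMoorePenroseInverse_pinv hS.isHermitian
  -- The orthogonal projection onto the range of `S`; it fixes `S`, `W`, `H` and therefore `T`.
  set P := S * pinv S with hP
  have hPt : Pᵀ = P := hpS.symm_left
  have hWP : W * P = W := mul_mul_pinv_of_posSemidef_sub hS hW h
  have hWt : Wᵀ = W := by simpa using hW.isHermitian.eq
  have hPW : P * W = W := by
    have := congrArg Matrix.transpose hWP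
    rwa [Matrix.transpose_mul, hPt, hWt] at this
  have hPS : P * S = S := hpS.mul_mul_self
  -- the null space of `H` is that of `S`
  have hPH : P * H = H := by
    have h0 : (1 - P) * H * ((1 - P) * H)ᴴ = 0 := by
      have : ((1 - P) * H)ᴴ = H * (1 - P) := by
        rw [Matrix.conjTranspose_eq_transpose_of_trivial, Matrix.transpose_mul, hHt,
          Matrix.transpose_sub, hPt, Matrix.transpose_one]
      rw [this, Matrix.mul_assoc, ← Matrix.mul_assoc H, hHS, ← Matrix.mul_assoc, Matrix.sub_mul,
        hPS, Matrix.one_mul, sub_self, Matrix.zero_mul]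
    have h1 := Matrix.self_mul_conjTranspose_eq_zero.1 h0
    rw [Matrix.sub_mul, Matrix.one_mul, sub_eq_zero] at h1
    exact h1.symm
  have hHP : H * P = H := by
    have := congrArg Matrix.transpose hPH
    rwa [Matrix.transpose_mul, hPt, hHt] at this
  have hPT : P * T = T := by
    rw [hT, ← Matrix.mul_assoc, ← Matrix.mul_assoc, hPH]
  have hTS : T * (W + pinv S) = P := by
    -- Writing `W = W S S⁺` with `S = H H` lets `H S⁺` be factored out on the right, leaving `1 + H
    -- W H`.
    have e1 : H * (W + pinv S) = N * (H * pinv S) := by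
      calc H * (W + pinv S) = H * W * P + H * pinv S := by
            rw [Matrix.mul_add, Matrix.mul_assoc H W, hWP]
        _ = N * (H * pinv S) := by
            rw [hNdef, Matrix.add_mul, Matrix.one_mul, hP, ← hHS, add_comm]
            simp only [Matrix.mul_assoc]
    rw [hT, Matrix.mul_assoc, e1, Matrix.mul_assoc, ← Matrix.mul_assoc N⁻¹, hNN, Matrix.one_mul,
      ← Matrix.mul_assoc, hHS]
  have hV : (W + pinv S).PosSemidef := hW.add (posSemidef_pinv hS)
  have hVt : (W + pinv S)ᵀ = W + pinv S := by simpa using hV.isHermitian.eq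
  have hST : (W + pinv S) * T = P := by
    have := congrArg Matrix.transpose hTS
    rwa [Matrix.transpose_mul, hPt, hTt, hVt] at this
  have hPV : P * (W + pinv S) = W + pinv S := by
    rw [Matrix.mul_add, hPW, hP, mul_pinv_comm hS, hpS.mul_mul_inv]
  -- Both products of `T` with `W + pinv S` equal the symmetric projection `P`, which acts as the
  -- identity on each factor; these are the Penrose conditions.
  refine (isMoorePenroseInverse_pinv hV.isHermitian).unique ⟨?_, ?_, ?_, ?_⟩
  · rw [hST, hPV]
  · rw [hTS, hPT]
  · rw [hST, hPt]
  · rw [hTS, hPt]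

end RemoteEstimation

/-! ### Gaussian measures: linear images, convolutions and exponential tilting. -/

namespace RemoteEstimation

theorem withDensity_map_eq {α β : Type*} [MeasurableSpace α] [MeasurableSpace β] (ν : Measure α)
    {f : α → β} (hf : Measurable f) {g : β → ENNReal} (hg : Measurable g) :
    (ν.map f).withDensity g = (ν.withDensity (g ∘ f)).map f := by
  ext s hs
  rw [withDensity_apply _ hs, Measure.map_apply hf hs, withDensity_apply _ (hf hs),
    setLIntegral_map hs hg hf]
  rfl

theorem measurable_toEuclideanLin {n p : ℕ} (A : Matrix (Fin p) (Fin n) ℝ) :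
    Measurable (Matrix.toEuclideanLin A) :=
  (LinearMap.continuous_of_finiteDimensional _).measurable

theorem inner_toEuclideanLin {n p : ℕ} (A : Matrix (Fin p) (Fin n) ℝ)
    (x : EuclideanSpace ℝ (Fin n)) (t : EuclideanSpace ℝ (Fin p)) :
    inner ℝ (Matrix.toEuclideanLin A x) t = inner ℝ x (Matrix.toEuclideanLin Aᵀ t) := by
  simp only [EuclideanSpace.inner_eq_star_dotProduct, star_trivial, Matrix.ofLp_toLpLin,
    Matrix.toLin'_apply]
  rw [Matrix.dotProduct_mulVec, Matrix.mulVec_transpose]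

theorem charFun_map_toEuclideanLin {n p : ℕ} (ν : Measure (EuclideanSpace ℝ (Fin n)))
    (A : Matrix (Fin p) (Fin n) ℝ) (t : EuclideanSpace ℝ (Fin p)) :
    charFun (ν.map (Matrix.toEuclideanLin A)) t = charFun ν (Matrix.toEuclideanLin Aᵀ t) := by
  rw [charFun_apply, charFun_apply,
    integral_map (measurable_toEuclideanLin A).aemeasurable (by fun_prop)]
  simp only [inner_toEuclideanLin]

/-- Comparing characteristic functions covers singular covariances and rectangular `A` uniformly. -/
theorem multivariateGaussian_map {n p : ℕ} {S : Matrix (Fin n) (Fin n) ℝ} (hS : S.PosSemidef)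
    (A : Matrix (Fin p) (Fin n) ℝ) :
    (multivariateGaussian 0 S).map (Matrix.toEuclideanLin A) =
      multivariateGaussian 0 (A * S * Aᵀ) := by
  have hAS : (A * S * Aᵀ).PosSemidef := by
    simpa using hS.mul_mul_conjTranspose_same A
  have := Measure.isProbabilityMeasure_map (μ := multivariateGaussian 0 S)
    (measurable_toEuclideanLin A).aemeasurable
  refine Measure.ext_of_charFun (funext fun t => ?_)
  rw [charFun_map_toEuclideanLin, charFun_multivariateGaussian hS,
    charFun_multivariateGaussian hAS]
  simp only [inner_zero_right, Matrix.ofLp_toLpLin, Matrix.toLin'_apply]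
  congr 4
  rw [← Matrix.mulVec_mulVec, ← Matrix.mulVec_mulVec, Matrix.dotProduct_mulVec _ A,
    Matrix.mulVec_transpose]

theorem multivariateGaussian_conv {n : ℕ} {S T : Matrix (Fin n) (Fin n) ℝ} (hS : S.PosSemidef)
    (hT : T.PosSemidef) :
    (multivariateGaussian 0 S).conv (multivariateGaussian 0 T) =
      multivariateGaussian 0 (S + T) := by
  refine Measure.ext_of_charFun (funext fun t => ?_)
  rw [charFun_conv, charFun_multivariateGaussian hS, charFun_multivariateGaussian hT,
    charFun_multivariateGaussian (hS.add hT), ← Complex.exp_add, Matrix.add_mulVec,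
    dotProduct_add]
  simp only [inner_zero_right]
  push_cast
  ring_nf

theorem multivariateGaussian_zero_zero {n : ℕ} :
    multivariateGaussian 0 (0 : Matrix (Fin n) (Fin n) ℝ) = Measure.dirac 0 := by
  refine Measure.ext_of_charFun (funext fun t => ?_)
  rw [charFun_multivariateGaussian Matrix.PosSemidef.zero]
  simp [charFun_apply]

section density

variable {E : Type*} [NormedAddCommGroup E] [InnerProductSpace ℝ E] [FiniteDimensional ℝ E]
  [MeasurableSpace E] [BorelSpace E]

/-- The standard Gaussian measure has density proportional to `exp (-‖x‖² / 2)`. -/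
theorem exists_withDensity_eq_smul_stdGaussian :
    ∃ c : ENNReal, c ≠ 0 ∧ c ≠ ⊤ ∧
      (volume : Measure E).withDensity (fun x => ENNReal.ofReal (Real.exp (-(1 / 2) * ‖x‖ ^ 2)))
        = c • stdGaussian E := by
  set f : E → ℝ := fun x => Real.exp (-(1 / 2) * ‖x‖ ^ 2) with hf
  have hfi : Integrable f := by
    have := (GaussianFourier.integrable_cexp_neg_mul_sq_norm_add (V := E) (b := 1 / 2)
      (by norm_num) 0 0).norm
    refine this.congr (Filter.Eventually.of_forall fun x => ?_)
    simp only [Complex.norm_exp, hf]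
    congr 1
    simp [← Complex.ofReal_pow]
  set c : ℝ := ∫ x, f x with hc
  have hcval : c = (Real.pi / (1 / 2)) ^ (Module.finrank ℝ E / 2 : ℝ) :=
    GaussianFourier.integral_rexp_neg_mul_sq_norm (by norm_num)
  have hcpos : 0 < c := by rw [hcval]; positivity
  refine ⟨ENNReal.ofReal c, by simpa using hcpos, ENNReal.ofReal_ne_top, ?_⟩
  have hfin := isFiniteMeasure_withDensity_ofReal hfi.2
  have hfin2 : IsFiniteMeasure (ENNReal.ofReal c • stdGaussian E) :=
    Measure.smul_finite _ ENNReal.ofReal_ne_top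
  refine Measure.ext_of_charFun (funext fun t => ?_)
  rw [charFun_apply, integral_withDensity_eq_integral_toReal_smul (by fun_prop)
    (Filter.Eventually.of_forall fun _ => ENNReal.ofReal_lt_top), charFun_apply,
    integral_smul_measure, ← charFun_apply, charFun_stdGaussian,
    ENNReal.toReal_ofReal hcpos.le]
  -- The Gaussian integral with imaginary linear term is the Fourier transform of the density; its
  -- prefactor is the normalising constant `c`, so no explicit value of `c` enters the comparison.
  have h1 := GaussianFourier.integral_cexp_neg_mul_sq_norm_add (V := E) (b := 1 / 2)
      (by norm_num) Complex.I t
  have h0 := GaussianFourier.integral_cexp_neg_mul_sq_norm (V := E) (b := 1 / 2) (by norm_num)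
  have hcc : (c : ℂ) = (Real.pi / (1 / 2)) ^ (Module.finrank ℝ E / 2 : ℂ) := by
    rw [← h0, hc, ← integral_complex_ofReal]
    congr 1; funext x; simp [hf]
  rw [← hcc] at h1
  rw [Complex.real_smul, show Complex.exp (-(‖t‖ : ℂ) ^ 2 / 2) =
    Complex.exp (Complex.I ^ 2 * ‖t‖ ^ 2 / (4 * (1 / 2))) by
      congr 1; rw [Complex.I_sq]; ring, ← h1]
  congr 1
  funext x
  rw [ENNReal.toReal_ofReal (Real.exp_nonneg _), Complex.real_smul, Complex.exp_add]
  push_cast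
  rw [real_inner_comm]
  ring_nf

end density

open scoped MatrixOrder in
/-- Multiplying the standard Gaussian density by `exp (-xᵀ M x / 2)` gives, up to a constant, the
Gaussian with covariance `(1 + M)⁻¹`. -/
theorem exists_stdGaussian_withDensity {n : ℕ} {M : Matrix (Fin n) (Fin n) ℝ}
    (hM : M.PosSemidef) :
    ∃ c : ENNReal,
      (stdGaussian (EuclideanSpace ℝ (Fin n))).withDensity
          (fun x => ENNReal.ofReal (Real.exp (-(1 / 2) * (x.ofLp ⬝ᵥ M *ᵥ x.ofLp))))
        = c • multivariateGaussian 0 (1 + M)⁻¹ := by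
  obtain ⟨c, hc0, hct, hc⟩ := exists_withDensity_eq_smul_stdGaussian
    (E := EuclideanSpace ℝ (Fin n))
  have hN : (1 + M).PosDef := Matrix.PosDef.one.add_posSemidef hM
  -- With `L² = 1 + M` the tilted exponent becomes `‖L x‖²`, so the tilted measure is, up to
  -- scaling, the image of the standard Gaussian under `K = L⁻¹`, whose covariance is `L⁻¹ L⁻¹ = (1
  -- + M)⁻¹`.
  set L := CFC.sqrt (1 + M) with hL
  have hLL : L * L = 1 + M := CFC.sqrt_mul_sqrt_self _ hN.posSemidef.nonneg
  have hLp : L.PosSemidef := Matrix.nonneg_iff_posSemidef.1 (CFC.sqrt_nonneg (1 + M))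
  have hLt : Lᵀ = L := by simpa using hLp.isHermitian.eq
  have hLdet : L.det ≠ 0 := by
    intro h
    have := hN.det_pos
    rw [← hLL, Matrix.det_mul, h] at this
    simp at this
  have hLu : IsUnit L.det := isUnit_iff_ne_zero.2 hLdet
  have hquad : ∀ x : EuclideanSpace ℝ (Fin n),
      ‖Matrix.toEuclideanLin L x‖ ^ 2 = ‖x‖ ^ 2 + x.ofLp ⬝ᵥ M *ᵥ x.ofLp := by
    intro x
    rw [← real_inner_self_eq_norm_sq, inner_toEuclideanLin, hLt,
      ← real_inner_self_eq_norm_sq]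
    simp only [EuclideanSpace.inner_eq_star_dotProduct, star_trivial, Matrix.ofLp_toLpLin,
      Matrix.toLin'_apply, Matrix.mulVec_mulVec, hLL, Matrix.add_mulVec, Matrix.one_mulVec,
      add_dotProduct]
    rw [dotProduct_comm (M *ᵥ _)]
  set K := Matrix.toEuclideanLin L⁻¹ with hK
  have hKm : Measurable K := measurable_toEuclideanLin _
  have hLK : ∀ x, Matrix.toEuclideanLin L (K x) = x := by
    intro x
    ext1
    simp [hK, Matrix.mulVec_mulVec, Matrix.mul_nonsing_inv _ hLu]
  have hdetK : LinearMap.det K ≠ 0 := by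
    have h2 : (Matrix.toEuclideanLin L).comp K = LinearMap.id := LinearMap.ext hLK
    have h3 := congrArg LinearMap.det h2
    rw [LinearMap.det_comp, LinearMap.det_id] at h3
    exact right_ne_zero_of_mul_eq_one h3
  set a : ENNReal := ENNReal.ofReal |(LinearMap.det K)⁻¹| with ha
  have ha0 : a ≠ 0 := by simp [ha, hdetK]
  have hvol : (volume : Measure (EuclideanSpace ℝ (Fin n))).map K = a • volume :=
    Measure.map_linearMap_addHaar_eq_smul_addHaar volume hdetK
  have hmeasM : Measurable (fun x : EuclideanSpace ℝ (Fin n) =>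
      ENNReal.ofReal (Real.exp (-(1 / 2) * (x.ofLp ⬝ᵥ M *ᵥ x.ofLp)))) := by
    have : Continuous (fun x : EuclideanSpace ℝ (Fin n) => x.ofLp ⬝ᵥ M *ᵥ x.ofLp) := by
      fun_prop
    fun_prop
  have hmeasN : Measurable (fun x : EuclideanSpace ℝ (Fin n) =>
      ENNReal.ofReal (Real.exp (-(1 / 2) * ‖Matrix.toEuclideanLin L x‖ ^ 2))) := by
    have := measurable_toEuclideanLin L
    fun_prop
  have hmeas1 : Measurable (fun x : EuclideanSpace ℝ (Fin n) =>
      ENNReal.ofReal (Real.exp (-(1 / 2) * ‖x‖ ^ 2))) := by fun_prop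
  -- the density of the image of the standard Gaussian
  have h1 : c • multivariateGaussian 0 (1 + M)⁻¹ =
      a • volume.withDensity (fun x : EuclideanSpace ℝ (Fin n) =>
        ENNReal.ofReal (Real.exp (-(1 / 2) * ‖Matrix.toEuclideanLin L x‖ ^ 2))) := by
    rw [← withDensity_smul_measure, ← hvol, withDensity_map_eq _ hKm hmeasN]
    have : (fun x : EuclideanSpace ℝ (Fin n) =>
        ENNReal.ofReal (Real.exp (-(1 / 2) * ‖Matrix.toEuclideanLin L x‖ ^ 2))) ∘ K =
        fun x => ENNReal.ofReal (Real.exp (-(1 / 2) * ‖x‖ ^ 2)) := by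
      funext x; simp only [Function.comp_apply, hLK]
    rw [this, hc, Measure.map_smul, ← multivariateGaussian_zero_one,
      multivariateGaussian_map Matrix.PosSemidef.one, Matrix.mul_one, Matrix.transpose_nonsing_inv,
      hLt, ← Matrix.mul_inv_rev, hLL]
  have h2 : c • (stdGaussian (EuclideanSpace ℝ (Fin n))).withDensity
          (fun x => ENNReal.ofReal (Real.exp (-(1 / 2) * (x.ofLp ⬝ᵥ M *ᵥ x.ofLp)))) =
      volume.withDensity (fun x : EuclideanSpace ℝ (Fin n) =>
        ENNReal.ofReal (Real.exp (-(1 / 2) * ‖Matrix.toEuclideanLin L x‖ ^ 2))) := by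
    rw [← withDensity_smul_measure, ← hc, ← withDensity_mul _ hmeas1 hmeasM]
    congr 1
    funext x
    rw [Pi.mul_apply, ← ENNReal.ofReal_mul (Real.exp_nonneg _), ← Real.exp_add, hquad, mul_add]
  -- With `ρ` the common Lebesgue density measure, `h1` says `c • N = a • ρ` and `h2` says `c •
  -- tilted = ρ`, so `c` cancels and only the Jacobian factor `a` survives.
  refine ⟨a⁻¹, ?_⟩
  have h3 := congrArg (fun ν => (c⁻¹ * a⁻¹) • ν) h1
  rw [← h2, smul_smul, smul_smul, smul_smul, mul_assoc, mul_assoc, mul_comm a⁻¹, ← mul_assoc,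
    ENNReal.inv_mul_cancel hc0 hct, one_mul, mul_assoc c⁻¹, ← mul_assoc (a⁻¹),
    ENNReal.inv_mul_cancel ha0 ENNReal.ofReal_ne_top, one_mul, ENNReal.inv_mul_cancel hc0 hct,
    one_smul] at h3
  exact h3.symm

open scoped MatrixOrder in
/-- Multiplying a Gaussian law by `exp (-xᵀ W x / 2)` gives, up to a constant, the Gaussian law
with covariance `(W + S⁻¹)⁻¹`. -/
theorem exists_multivariateGaussian_withDensity {n : ℕ} {S W : Matrix (Fin n) (Fin n) ℝ}
    (hS : S.PosSemidef) (hW : W.PosSemidef) (h : (S - pinv (W + pinv S)).PosSemidef) :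
    ∃ c : ENNReal,
      (multivariateGaussian 0 S).withDensity
          (fun x => ENNReal.ofReal (Real.exp (-(1 / 2) * (x.ofLp ⬝ᵥ W *ᵥ x.ofLp))))
        = c • multivariateGaussian 0 (pinv (W + pinv S)) := by
  -- `N(0, S)` is the image of the standard Gaussian under `H`, even when `S` is singular and has no
  -- density. The weight pulls back along `H` to the form `H W H`; the tilt is made there and pushed
  -- forward again.
  set H := CFC.sqrt S with hH
  have hHH : H * H = S := CFC.sqrt_mul_sqrt_self _ hS.nonneg
  have hHp : H.PosSemidef := Matrix.nonneg_iff_posSemidef.1 (CFC.sqrt_nonneg S)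
  have hHt : Hᵀ = H := by simpa using hHp.isHermitian.eq
  have hM : (H * W * H).PosSemidef := by
    have := hW.mul_mul_conjTranspose_same H
    rwa [hHp.isHermitian.eq] at this
  obtain ⟨c, hc⟩ := exists_stdGaussian_withDensity hM
  refine ⟨c, ?_⟩
  have hmeasW : Measurable (fun x : EuclideanSpace ℝ (Fin n) =>
      ENNReal.ofReal (Real.exp (-(1 / 2) * (x.ofLp ⬝ᵥ W *ᵥ x.ofLp)))) := by
    have : Continuous (fun x : EuclideanSpace ℝ (Fin n) => x.ofLp ⬝ᵥ W *ᵥ x.ofLp) := by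
      fun_prop
    fun_prop
  have hinv : ((1 + H * W * H)⁻¹).PosSemidef :=
    (Matrix.PosDef.one.add_posSemidef hM).inv.posSemidef
  rw [pinv_add_pinv_eq hW hHp hHH h]
  conv_lhs => rw [← hHH, show H * H = H * 1 * Hᵀ by rw [Matrix.mul_one, hHt],
    ← multivariateGaussian_map Matrix.PosSemidef.one, multivariateGaussian_zero_one,
    withDensity_map_eq _ (measurable_toEuclideanLin H) hmeasW]
  have : (fun x : EuclideanSpace ℝ (Fin n) =>
      ENNReal.ofReal (Real.exp (-(1 / 2) * (x.ofLp ⬝ᵥ W *ᵥ x.ofLp)))) ∘ Matrix.toEuclideanLin H =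
      fun x => ENNReal.ofReal (Real.exp (-(1 / 2) * (x.ofLp ⬝ᵥ (H * W * H) *ᵥ x.ofLp))) := by
    funext x
    simp only [Function.comp_apply, Matrix.ofLp_toLpLin, Matrix.toLin'_apply]
    congr 3
    rw [← Matrix.mulVec_mulVec, ← Matrix.mulVec_mulVec, Matrix.dotProduct_mulVec x.ofLp,
      ← Matrix.mulVec_transpose, hHt]
  rw [this, hc, Measure.map_smul, multivariateGaussian_map hinv, hHt]

end RemoteEstimation

/-! ### Joins of σ-algebras, independence and conditional expectation. -/

namespace RemoteEstimation

section sigmaAlgebra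

variable {Ω : Type*}

theorem isPiSystem_inter_measurableSet (m₁ m₂ : MeasurableSpace Ω) :
    IsPiSystem {s | ∃ a b, MeasurableSet[m₁] a ∧ MeasurableSet[m₂] b ∧ s = a ∩ b} := by
  rintro _ ⟨a, b, ha, hb, rfl⟩ _ ⟨a', b', ha', hb', rfl⟩ -
  exact ⟨a ∩ a', b ∩ b', ha.inter ha', hb.inter hb', Set.inter_inter_inter_comm a b a' b'⟩

theorem sup_eq_generateFrom_inter (m₁ m₂ : MeasurableSpace Ω) :
    m₁ ⊔ m₂ = MeasurableSpace.generateFrom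
      {s | ∃ a b, MeasurableSet[m₁] a ∧ MeasurableSet[m₂] b ∧ s = a ∩ b} := by
  refine le_antisymm (sup_le (fun s hs => ?_) (fun s hs => ?_))
    (MeasurableSpace.generateFrom_le ?_)
  · exact MeasurableSpace.measurableSet_generateFrom
      ⟨s, Set.univ, hs, MeasurableSet.univ, (Set.inter_univ s).symm⟩
  · exact MeasurableSpace.measurableSet_generateFrom
      ⟨Set.univ, s, MeasurableSet.univ, hs, (Set.univ_inter s).symm⟩
  · rintro _ ⟨a, b, ha, hb, rfl⟩
    exact MeasurableSet.inter (le_sup_left (a := m₁) _ ha) (le_sup_right (b := m₂) _ hb)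

theorem biSup_Icc_succ {L : Type*} [CompleteLattice L] (f : ℕ → L) (k : ℕ) :
    ⨆ j ∈ Finset.Icc 1 (k + 1), f j = (⨆ j ∈ Finset.Icc 1 k, f j) ⊔ f (k + 1) := by
  rw [← Finset.insert_Icc_right_eq_Icc_add_one (by omega), Finset.iSup_insert, sup_comm]

variable [mΩ : MeasurableSpace Ω] {μ : Measure Ω}

/-- On the π-system of intersections, `μ(a ∩ b ∩ c) = μ(a ∩ b) μ(c) = μ(a) μ(b) μ(c) = μ(a) μ(b ∩
c)`. -/
theorem indep_sup_right_of_indep [IsZeroOrProbabilityMeasure μ] {m₁ m₂ m₃ : MeasurableSpace Ω}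
    (h₁ : m₁ ≤ mΩ) (h₂ : m₂ ≤ mΩ) (h₃ : m₃ ≤ mΩ) (h12 : Indep m₁ m₂ μ)
    (h123 : Indep (m₁ ⊔ m₂) m₃ μ) : Indep m₁ (m₂ ⊔ m₃) μ := by
  refine IndepSets.indep h₁ (sup_le h₂ h₃) (@MeasurableSpace.isPiSystem_measurableSet Ω m₁)
    (isPiSystem_inter_measurableSet m₂ m₃) (@MeasurableSpace.generateFrom_measurableSet Ω m₁).symm
    (sup_eq_generateFrom_inter m₂ m₃) ?_
  rw [IndepSets_iff]
  rintro a _ ha ⟨b, c, hb, hc, rfl⟩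
  rw [Indep_iff] at h12 h123
  have h23 : μ (b ∩ c) = μ b * μ c := h123 b c (le_sup_right (a := m₁) _ hb) hc
  rw [← Set.inter_assoc, h123 _ _ (MeasurableSet.inter (le_sup_left (a := m₁) _ ha)
    (le_sup_right (b := m₂) _ hb)) hc, h12 a b ha hb, h23, mul_assoc]

/-- Preimages change only by null sets. This is needed because conditional expectations are
identified with explicit filter formulas only almost everywhere. -/
theorem indep_comap_congr {β : Type*} [MeasurableSpace β] {f g : Ω → β} {m : MeasurableSpace Ω}
    (hfg : f =ᵐ[μ] g) (h : Indep (MeasurableSpace.comap f inferInstance) m μ) :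
    Indep (MeasurableSpace.comap g inferInstance) m μ := by
  rw [Indep_iff] at h ⊢
  rintro _ t ⟨u, hu, rfl⟩ ht
  have e1 : g ⁻¹' u =ᵐ[μ] f ⁻¹' u := by
    filter_upwards [hfg] with s hs
    change (g s ∈ u) = (f s ∈ u)
    rw [hs]
  rw [measure_congr e1, measure_congr (e1.inter (ae_eq_refl t))]
  exact h _ t ⟨u, hu, rfl⟩ ht

/-- A conditional expectation given `m₁ ⊔ m₂` is determined by the integrals over the sets
`a ∩ b` with `a ∈ m₁` and `b ∈ m₂`. -/
theorem ae_eq_condExp_sup [IsFiniteMeasure μ] {m₁ m₂ : MeasurableSpace Ω}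
    (h₁ : m₁ ≤ mΩ) (h₂ : m₂ ≤ mΩ) {f g : Ω → ℝ} (hf : Integrable f μ) (hg : Integrable g μ)
    (hgm : StronglyMeasurable[m₁ ⊔ m₂] g)
    (h : ∀ a b, MeasurableSet[m₁] a → MeasurableSet[m₂] b →
      ∫ s in a ∩ b, g s ∂μ = ∫ s in a ∩ b, f s ∂μ) :
    g =ᵐ[μ] μ[f | m₁ ⊔ m₂] := by
  have hle : m₁ ⊔ m₂ ≤ mΩ := sup_le h₁ h₂
  refine ae_eq_condExp_of_forall_setIntegral_eq hle hf (fun _ _ _ => hg.integrableOn)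
    (fun s hs _ => ?_) hgm.aestronglyMeasurable
  induction s, hs using MeasurableSpace.induction_on_inter (sup_eq_generateFrom_inter m₁ m₂)
    (isPiSystem_inter_measurableSet m₁ m₂) with
  | empty => simp
  | basic t ht =>
    obtain ⟨a, b, ha, hb, rfl⟩ := ht
    exact h a b ha hb
  | compl t htm ih =>
    have ih := ih (measure_lt_top _ _)
    have hu := h Set.univ Set.univ MeasurableSet.univ MeasurableSet.univ
    simp only [Set.inter_self, setIntegral_univ] at hu
    rw [← integral_add_compl (hle _ htm) hf, ← integral_add_compl (hle _ htm) hg, ih] at hu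
    exact add_left_cancel hu
  | iUnion t hd htm ih =>
    rw [integral_iUnion (fun i => hle _ (htm i)) hd hg.integrableOn,
      integral_iUnion (fun i => hle _ (htm i)) hd hf.integrableOn]
    exact tsum_congr fun i => ih i (measure_lt_top _ _)

end sigmaAlgebra

/-! ### Moments, sums and deconvolution of Gaussian vectors. -/

section gaussian

variable {Ω : Type*} [MeasurableSpace Ω] {μ : Measure Ω}

theorem integral_eval_multivariateGaussian {n : ℕ} (S : Matrix (Fin n) (Fin n) ℝ)
    (i : Fin n) : ∫ z, z i ∂(multivariateGaussian 0 S) = 0 := by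
  have h := (EuclideanSpace.proj (𝕜 := ℝ) i).integral_comp_comm
    (IsGaussian.integrable_id (μ := multivariateGaussian 0 S))
  simpa using h

theorem integral_mul_eval_multivariateGaussian {n : ℕ} {S : Matrix (Fin n) (Fin n) ℝ}
    (hS : S.PosSemidef) (i j : Fin n) :
    ∫ z, z i * z j ∂(multivariateGaussian 0 S) = S i j := by
  rw [← covariance_eval_multivariateGaussian (μ := 0) hS, covariance]
  simp only [integral_eval_multivariateGaussian, sub_zero]

theorem hasLaw_gaussian_add {n p q : ℕ} {S : Matrix (Fin p) (Fin p) ℝ}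
    {T : Matrix (Fin q) (Fin q) ℝ} (hS : S.PosSemidef) (hT : T.PosSemidef)
    {X : Ω → EuclideanSpace ℝ (Fin p)} {Y : Ω → EuclideanSpace ℝ (Fin q)}
    (hX : HasLaw X (multivariateGaussian 0 S) μ) (hY : HasLaw Y (multivariateGaussian 0 T) μ)
    (hXY : IndepFun X Y μ) (F : Matrix (Fin n) (Fin p) ℝ) (G : Matrix (Fin n) (Fin q) ℝ) :
    HasLaw (fun s => Matrix.toEuclideanLin F (X s) + Matrix.toEuclideanLin G (Y s))
      (multivariateGaussian 0 (F * S * Fᵀ + G * T * Gᵀ)) μ := by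
  have hF := measurable_toEuclideanLin F
  have hG := measurable_toEuclideanLin G
  have hX' := hF.comp_aemeasurable hX.aemeasurable
  have hY' := hG.comp_aemeasurable hY.aemeasurable
  have : IsProbabilityMeasure μ := hX.isProbabilityMeasure
  refine ⟨hX'.add hY', ?_⟩
  have h := (hXY.comp hF hG).map_add_eq_map_conv_map₀ hX' hY'
  rw [← AEMeasurable.map_map_of_aemeasurable hF.aemeasurable hX.aemeasurable,
    ← AEMeasurable.map_map_of_aemeasurable hG.aemeasurable hY.aemeasurable, hX.map_eq, hY.map_eq,
    multivariateGaussian_map hS, multivariateGaussian_map hT, multivariateGaussian_conv] at h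
  · exact h
  · simpa using hS.mul_mul_conjTranspose_same F
  · simpa using hT.mul_mul_conjTranspose_same G

/-- Used to identify the covariance produced by a filter step with the steady-state `P̄`. -/
theorem eq_of_hasLaw_gaussian {n : ℕ} {S P : Matrix (Fin n) (Fin n) ℝ} (hS : S.PosSemidef)
    {X : Ω → EuclideanSpace ℝ (Fin n)} (hX : HasLaw X (multivariateGaussian 0 S) μ)
    (hP : ∀ i j, ∫ s, X s i * X s j ∂μ = P i j) : S = P := by
  ext i j
  rw [← hP, ← integral_mul_eval_multivariateGaussian hS, ← hX.map_eq,
    integral_map hX.aemeasurable (by fun_prop)]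

/-- If `X + Y` and `Y` are centred Gaussian and `X`, `Y` are independent, then so is `X`, and its
covariance is the difference of the covariances. -/
theorem hasLaw_gaussian_of_add {n : ℕ} {S T : Matrix (Fin n) (Fin n) ℝ}
    (hS : S.PosSemidef) (hT : T.PosSemidef) {X Y : Ω → EuclideanSpace ℝ (Fin n)}
    (hX : AEMeasurable X μ)
    (hXY : HasLaw (X + Y) (multivariateGaussian 0 S) μ)
    (hY : HasLaw Y (multivariateGaussian 0 T) μ) (hind : IndepFun X Y μ) :
    (S - T).PosSemidef ∧ HasLaw X (multivariateGaussian 0 (S - T)) μ := by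
  have : IsProbabilityMeasure μ := hY.isProbabilityMeasure
  have := Measure.isProbabilityMeasure_map hX
  -- The characteristic function of `Y` never vanishes, so it can be divided out of that of `X + Y`.
  have hchar : ∀ t, charFun (μ.map X) t = Complex.exp (-(t.ofLp ⬝ᵥ (S - T) *ᵥ t.ofLp : ℝ) / 2) := by
    intro t
    have h := congrFun (hind.charFun_map_add_eq_mul hX hY.aemeasurable) t
    rw [Pi.mul_apply, hXY.map_eq, hY.map_eq, charFun_multivariateGaussian hS,
      charFun_multivariateGaussian hT] at h
    refine mul_right_cancel₀ (Complex.exp_ne_zero _) (h.symm.trans ?_)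
    rw [← Complex.exp_add]
    congr 1
    simp only [inner_zero_right, Matrix.sub_mulVec, dotProduct_sub]
    push_cast
    ring
  have hps : (S - T).PosSemidef := by
    refine Matrix.PosSemidef.of_dotProduct_mulVec_nonneg (hS.isHermitian.sub hT.isHermitian)
      fun u => ?_
    -- A characteristic function is bounded by `1`, which forces the quadratic form of `S - T` to be
    -- nonnegative.
    have h := norm_charFun_le_one (μ := μ.map X) (t := WithLp.toLp 2 u)
    rw [hchar, Complex.norm_exp] at h
    have h2 := Real.exp_le_one_iff.1 h
    rw [← Complex.ofReal_neg, ← Complex.ofReal_ofNat, ← Complex.ofReal_div,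
      Complex.ofReal_re] at h2
    simp only [star_trivial]
    linarith
  refine ⟨hps, hX, Measure.ext_of_charFun (funext fun t => ?_)⟩
  rw [hchar, charFun_multivariateGaussian hps]
  simp only [inner_zero_right]
  push_cast
  ring_nf

end gaussian

end RemoteEstimation

/-! ### One step of the Kalman filter. -/

namespace RemoteEstimation

/-- The σ-algebra generated by a random variable. -/
@[reducible] def sigmaGen {Ω β : Type*} [MeasurableSpace β] (f : Ω → β) : MeasurableSpace Ω :=
  MeasurableSpace.comap f inferInstance

section kalman

variable {Ω : Type*} [mΩ : MeasurableSpace Ω] {μ : Measure Ω}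

theorem covariance_inner_gaussian {n : ℕ} {S : Matrix (Fin n) (Fin n) ℝ} (hS : S.PosSemidef)
    {X : Ω → EuclideanSpace ℝ (Fin n)} (hX : HasLaw X (multivariateGaussian 0 S) μ)
    (a b : EuclideanSpace ℝ (Fin n)) :
    cov[fun s => inner ℝ a (X s), fun s => inner ℝ b (X s); μ] = a.ofLp ⬝ᵥ S *ᵥ b.ofLp := by
  rw [← covarianceBilin_multivariateGaussian (μ := 0) hS, covarianceBilin_apply_eq_cov
    IsGaussian.memLp_two_id, ← hX.map_eq, covariance_map (by fun_prop) (by fun_prop)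
    hX.aemeasurable]
  rfl

theorem memLp_two_inner_gaussian {n : ℕ} {S : Matrix (Fin n) (Fin n) ℝ}
    {X : Ω → EuclideanSpace ℝ (Fin n)} (hX : HasLaw X (multivariateGaussian 0 S) μ)
    (a : EuclideanSpace ℝ (Fin n)) : MemLp (fun s => inner ℝ a (X s)) 2 μ :=
  hX.hasGaussianLaw.memLp_two.const_inner a

theorem covariance_inner_gaussian_add {n p q r : ℕ} {S : Matrix (Fin p) (Fin p) ℝ}
    {T : Matrix (Fin q) (Fin q) ℝ} (hS : S.PosSemidef) (hT : T.PosSemidef)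
    {X : Ω → EuclideanSpace ℝ (Fin p)} {Y : Ω → EuclideanSpace ℝ (Fin q)}
    (hX : HasLaw X (multivariateGaussian 0 S) μ) (hY : HasLaw Y (multivariateGaussian 0 T) μ)
    (hXY : IndepFun X Y μ) (F : Matrix (Fin n) (Fin p) ℝ) (G : Matrix (Fin n) (Fin q) ℝ)
    (H : Matrix (Fin r) (Fin p) ℝ) (J : Matrix (Fin r) (Fin q) ℝ)
    (a : EuclideanSpace ℝ (Fin n)) (b : EuclideanSpace ℝ (Fin r)) :
    cov[fun s => inner ℝ a (Matrix.toEuclideanLin F (X s) + Matrix.toEuclideanLin G (Y s)),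
      fun s => inner ℝ b (Matrix.toEuclideanLin H (X s) + Matrix.toEuclideanLin J (Y s)); μ] =
      a.ofLp ⬝ᵥ (F * S * Hᵀ + G * T * Jᵀ) *ᵥ b.ofLp := by
  have : IsProbabilityMeasure μ := hX.isProbabilityMeasure
  have key : ∀ {k l : ℕ} (M : Matrix (Fin k) (Fin l) ℝ) (c : EuclideanSpace ℝ (Fin k))
      (z : EuclideanSpace ℝ (Fin l)), inner ℝ c (Matrix.toEuclideanLin M z) =
        inner ℝ (Matrix.toEuclideanLin Mᵀ c) z := by
    intro k l M c z
    rw [inner_toEuclideanLin, Matrix.transpose_transpose]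
  simp only [inner_add_right, key]
  have hind : ∀ c d, cov[fun s => inner ℝ c (X s), fun s => inner ℝ d (Y s); μ] = 0 := by
    intro c d
    exact (hXY.comp (φ := fun x => inner ℝ c x) (ψ := fun x => inner ℝ d x) (by fun_prop)
      (by fun_prop)).covariance_eq_zero
      (memLp_two_inner_gaussian hX c) (memLp_two_inner_gaussian hY d)
  have mX := fun c => memLp_two_inner_gaussian hX c
  have mY := fun c => memLp_two_inner_gaussian hY c
  change cov[(fun s => inner ℝ (Matrix.toEuclideanLin Fᵀ a) (X s)) +
      (fun s => inner ℝ (Matrix.toEuclideanLin Gᵀ a) (Y s)),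
      (fun s => inner ℝ (Matrix.toEuclideanLin Hᵀ b) (X s)) +
      (fun s => inner ℝ (Matrix.toEuclideanLin Jᵀ b) (Y s)); μ] = _
  rw [covariance_add_left (mX _) (mY _) ((mX _).add (mY _)),
    covariance_add_right (mX _) (mX _) (mY _), covariance_add_right (mY _) (mX _) (mY _),
    hind, covariance_comm (fun s => inner ℝ _ (Y s)) (fun s => inner ℝ _ (X s)), hind,
    covariance_inner_gaussian hS hX, covariance_inner_gaussian hT hY, add_zero, zero_add,
    Matrix.add_mulVec, dotProduct_add]
  simp only [Matrix.ofLp_toLpLin, Matrix.toLin'_apply, ← Matrix.mulVec_mulVec]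
  rw [Matrix.dotProduct_mulVec a.ofLp F, Matrix.dotProduct_mulVec a.ofLp G,
    ← Matrix.mulVec_transpose, ← Matrix.mulVec_transpose]

/-- Joint Gaussianity is what upgrades uncorrelatedness of the residual and the innovation to
independence. -/
theorem hasGaussianLaw_linear_prod {n p q r : ℕ} {X : Ω → EuclideanSpace ℝ (Fin p)}
    {Y : Ω → EuclideanSpace ℝ (Fin q)} (hXY : HasGaussianLaw (fun s => (X s, Y s)) μ)
    (F : Matrix (Fin n) (Fin p) ℝ) (G : Matrix (Fin n) (Fin q) ℝ)
    (H : Matrix (Fin r) (Fin p) ℝ) (J : Matrix (Fin r) (Fin q) ℝ) :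
    HasGaussianLaw (fun s => (Matrix.toEuclideanLin F (X s) + Matrix.toEuclideanLin G (Y s),
      Matrix.toEuclideanLin H (X s) + Matrix.toEuclideanLin J (Y s))) μ :=
  hXY.map_fun (LinearMap.toContinuousLinearMap
    (((Matrix.toEuclideanLin F).coprod (Matrix.toEuclideanLin G)).prod
      ((Matrix.toEuclideanLin H).coprod (Matrix.toEuclideanLin J))))

/-- One step of the Kalman filter, for a state with a Gaussian estimation error that is independent
of the past information `S`. -/
theorem kalman_step {Ω : Type*} {S S' : MeasurableSpace Ω} [mΩ : MeasurableSpace Ω]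
    {μ : Measure Ω} [IsProbabilityMeasure μ] {n m : ℕ} {A Q P : Matrix (Fin n) (Fin n) ℝ}
    {C : Matrix (Fin m) (Fin n) ℝ} {R : Matrix (Fin m) (Fin m) ℝ}
    (hP : P.PosSemidef) (hQ : Q.PosSemidef) (hR : R.PosDef)
    (hS : S ≤ mΩ) {x E w x' : Ω → EuclideanSpace ℝ (Fin n)}
    {v y' : Ω → EuclideanSpace ℝ (Fin m)} (hxm : Measurable x) (hwm : Measurable w)
    (hvm : Measurable v) (hEm : Measurable[S] E) (hEi : Integrable E μ)
    (hx' : ∀ s, x' s = Matrix.toEuclideanLin A (x s) + w s)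
    (hy' : ∀ s, y' s = Matrix.toEuclideanLin C (x' s) + v s)
    (he : HasLaw (x - E) (multivariateGaussian 0 P) μ)
    (hw : HasLaw w (multivariateGaussian 0 Q) μ) (hv : HasLaw v (multivariateGaussian 0 R) μ)
    (hie : Indep S (sigmaGen (x - E)) μ)
    (hiw : Indep (S ⊔ sigmaGen (x - E))
      (sigmaGen w) μ)
    (hiv : Indep (S ⊔ (sigmaGen (x - E) ⊔
      sigmaGen w)) (sigmaGen v) μ)
    (hS' : S' = S ⊔ sigmaGen y') :
    ∃ P' : Matrix (Fin n) (Fin n) ℝ, P'.PosSemidef ∧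
      HasLaw (x' - μ[x' | S']) (multivariateGaussian 0 P') μ ∧
      Indep S' (MeasurableSpace.comap (x' - μ[x' | S']) inferInstance) μ ∧
      (A * P * Aᵀ + Q - P').PosSemidef ∧
      HasLaw (fun s => (μ[x' | S']) s - Matrix.toEuclideanLin A (E s))
        (multivariateGaussian 0 (A * P * Aᵀ + Q - P')) μ ∧
      Indep S (MeasurableSpace.comap
        (fun s => (μ[x' | S']) s - Matrix.toEuclideanLin A (E s)) inferInstance) μ := by
  have hEm' : Measurable E := hEm.mono hS le_rfl
  have hem : Measurable (x - E) := hxm.sub hEm'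
  have hme_le : sigmaGen (x - E) ≤ mΩ := hem.comap_le
  have hmw_le : sigmaGen w ≤ mΩ := hwm.comap_le
  have hmv_le : sigmaGen v ≤ mΩ := hvm.comap_le
  -- independence of the three noise sources and the past
  have hSew : Indep S (sigmaGen (x - E) ⊔ sigmaGen w) μ :=
    indep_sup_right_of_indep hS hme_le hmw_le hie hiw
  have hSall : Indep S (sigmaGen (x - E) ⊔ sigmaGen w ⊔ sigmaGen v) μ :=
    indep_sup_right_of_indep hS (sup_le hme_le hmw_le) hmv_le hSew hiv
  have hew : IndepFun (x - E) w μ :=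
    (IndepFun_iff_Indep _ _ _).2 (indep_of_indep_of_le_left hiw le_sup_right)
  have one : ∀ {k : ℕ} (u : EuclideanSpace ℝ (Fin k)),
      Matrix.toEuclideanLin (1 : Matrix (Fin k) (Fin k) ℝ) u = u := by
    intro k u; ext1; simp
  -- the prior error
  set eps : Ω → EuclideanSpace ℝ (Fin n) :=
    fun s => Matrix.toEuclideanLin A ((x - E) s) + w s with heps
  have heps_x : ∀ s, eps s = x' s - Matrix.toEuclideanLin A (E s) := by
    intro s
    simp only [heps, hx', Pi.sub_apply, map_sub]
    abel
  have heps_meas : Measurable[sigmaGen (x - E) ⊔ sigmaGen w] eps :=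
    (((measurable_toEuclideanLin A).comp (comap_measurable (x - E))).mono le_sup_left le_rfl).add
      ((comap_measurable w).mono le_sup_right le_rfl)
  have heps_m : Measurable eps := heps_meas.mono (sup_le hme_le hmw_le) le_rfl
  set Pm := A * P * Aᵀ + Q with hPm
  have hPmp : Pm.PosSemidef :=
    Matrix.PosSemidef.add (by simpa using hP.mul_mul_conjTranspose_same A) hQ
  have heps_law : HasLaw eps (multivariateGaussian 0 Pm) μ := by
    have := hasLaw_gaussian_add hP hQ he hw hew A 1
    simpa only [one, Matrix.one_mul, Matrix.transpose_one, Matrix.mul_one] using this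
  have heps_v : IndepFun eps v μ :=
    (IndepFun_iff_Indep _ _ _).2 (indep_of_indep_of_le_left hiv
      (heps_meas.comap_le.trans le_sup_right))
  -- the innovation
  set z : Ω → EuclideanSpace ℝ (Fin m) := fun s => Matrix.toEuclideanLin C (eps s) + v s with hz
  have hz_meas : Measurable[sigmaGen (x - E) ⊔ sigmaGen w ⊔ sigmaGen v] z :=
    (((measurable_toEuclideanLin C).comp heps_meas).mono le_sup_left le_rfl).add
      ((comap_measurable v).mono le_sup_right le_rfl)
  have hz_m : Measurable z := hz_meas.mono (sup_le (sup_le hme_le hmw_le) hmv_le) le_rfl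
  have hzy : ∀ s, y' s = z s + Matrix.toEuclideanLin C (Matrix.toEuclideanLin A (E s)) := by
    intro s
    simp only [hz, heps_x, hy', map_sub]
    abel
  have hCP : (C * Pm * Cᵀ).PosSemidef := by simpa using hPmp.mul_mul_conjTranspose_same C
  have hZ : (C * Pm * Cᵀ + R).PosDef := hR.posSemidef_add hCP
  have hZu : IsUnit (C * Pm * Cᵀ + R).det :=
    (Matrix.isUnit_iff_isUnit_det _).1 hZ.isUnit
  -- The Kalman gain, chosen so that the residual `eps - K z` is uncorrelated with the innovation
  -- `z`. The inverse is genuine because `R` is positive definite.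
  set K := Pm * Cᵀ * (C * Pm * Cᵀ + R)⁻¹ with hK
  set r : Ω → EuclideanSpace ℝ (Fin n) := fun s => eps s - Matrix.toEuclideanLin K (z s) with hr
  have hr_meas : Measurable[sigmaGen (x - E) ⊔ sigmaGen w ⊔ sigmaGen v] r :=
    (heps_meas.mono le_sup_left le_rfl).sub ((measurable_toEuclideanLin K).comp hz_meas)
  have hr_m : Measurable r := hr_meas.mono (sup_le (sup_le hme_le hmw_le) hmv_le) le_rfl
  have hr_eq : r = fun s => Matrix.toEuclideanLin (1 - K * C) (eps s) +
      Matrix.toEuclideanLin (-K) (v s) := by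
    funext s
    simp only [hr, hz]
    ext1
    simp only [WithLp.ofLp_sub, WithLp.ofLp_add, Matrix.ofLp_toLpLin, Matrix.toLin'_apply,
      Matrix.sub_mulVec, Matrix.mulVec_add, Matrix.neg_mulVec, Matrix.one_mulVec,
      Matrix.mulVec_mulVec, Pi.sub_apply, Pi.add_apply, Pi.neg_apply]
    ring
  have hz_eq : z = fun s => Matrix.toEuclideanLin C (eps s) + Matrix.toEuclideanLin 1 (v s) := by
    funext s
    simp only [hz, one]
  have hr_law := hasLaw_gaussian_add hPmp hR.posSemidef heps_law hv heps_v (1 - K * C) (-K)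
  rw [← hr_eq] at hr_law
  set P' := (1 - K * C) * Pm * (1 - K * C)ᵀ + -K * R * (-K)ᵀ with hP'
  have hP'p : P'.PosSemidef := by
    refine Matrix.PosSemidef.add ?_ ?_
    · simpa only [Matrix.conjTranspose_eq_transpose_of_trivial] using
        hPmp.mul_mul_conjTranspose_same (1 - K * C)
    · simpa only [Matrix.conjTranspose_eq_transpose_of_trivial] using
        hR.posSemidef.mul_mul_conjTranspose_same (-K)
  have hrz : IndepFun r z μ := by
    have hG := hasGaussianLaw_linear_prod
      (IndepFun.hasGaussianLaw heps_law.hasGaussianLaw hv.hasGaussianLaw heps_v)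
      (1 - K * C) (-K) C 1
    rw [hr_eq, hz_eq]
    refine hG.indepFun_of_covariance_inner fun a b => ?_
    rw [covariance_inner_gaussian_add hPmp hR.posSemidef heps_law hv heps_v]
    have : (1 - K * C) * Pm * Cᵀ + -K * R * (1 : Matrix (Fin m) (Fin m) ℝ)ᵀ = 0 := by
      have hKZ : K * (C * Pm * Cᵀ + R) = Pm * Cᵀ := by
        rw [hK, Matrix.mul_assoc, Matrix.nonsing_inv_mul _ hZu, Matrix.mul_one]
      rw [Matrix.mul_add] at hKZ
      rw [Matrix.sub_mul, Matrix.sub_mul, Matrix.one_mul, ← hKZ, Matrix.transpose_one,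
        Matrix.mul_one, Matrix.neg_mul]
      simp only [Matrix.mul_assoc]
      abel
    rw [this, Matrix.zero_mulVec, dotProduct_zero]
  have hrzS : Indep (sigmaGen r ⊔ sigmaGen z) S μ :=
    (indep_of_indep_of_le_right hSall (sup_le hr_meas.comap_le hz_meas.comap_le)).symm
  have hr_ind : Indep (sigmaGen r) (sigmaGen z ⊔ S) μ :=
    indep_sup_right_of_indep hr_m.comap_le hz_m.comap_le hS
      ((IndepFun_iff_Indep _ _ _).1 hrz) hrzS
  have hAE : Measurable[S] (fun s => Matrix.toEuclideanLin A (E s)) :=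
    (measurable_toEuclideanLin A).comp hEm
  have hCAE : Measurable[S] (fun s => Matrix.toEuclideanLin C (Matrix.toEuclideanLin A (E s))) :=
    (measurable_toEuclideanLin C).comp hAE
  -- The measurement and the innovation differ by the `S`-measurable prediction `C A E`, so either
  -- generates the same information over `S`.
  have hS'z : S' = sigmaGen z ⊔ S := by
    rw [hS', sup_comm]
    refine le_antisymm (sup_le ?_ le_sup_right) (sup_le ?_ le_sup_right)
    · have : Measurable[sigmaGen z ⊔ S] y' := by
        rw [funext hzy]
        exact ((comap_measurable z).mono le_sup_left le_rfl).add (hCAE.mono le_sup_right le_rfl)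
      exact this.comap_le
    · have : Measurable[sigmaGen y' ⊔ S] z := by
        have h2 : z = fun s => y' s - Matrix.toEuclideanLin C (Matrix.toEuclideanLin A (E s)) :=
          funext fun s => by rw [hzy]; abel
        rw [h2]
        exact ((comap_measurable y').mono le_sup_left le_rfl).sub (hCAE.mono le_sup_right le_rfl)
      exact this.comap_le
  have hS'le : S' ≤ mΩ := by rw [hS'z]; exact sup_le hz_m.comap_le hS
  -- the filter update
  set g : Ω → EuclideanSpace ℝ (Fin n) :=
    fun s => Matrix.toEuclideanLin A (E s) + Matrix.toEuclideanLin K (z s) with hg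
  have hgm : Measurable[S'] g := by
    rw [hS'z]
    exact (hAE.mono le_sup_right le_rfl).add
      ((measurable_toEuclideanLin K).comp ((comap_measurable z).mono le_sup_left le_rfl))
  have hz_law := hasLaw_gaussian_add hPmp hR.posSemidef heps_law hv heps_v C 1
  rw [← hz_eq] at hz_law
  have hri : Integrable r μ := hr_law.hasGaussianLaw.integrable
  have hgi : Integrable g μ :=
    ((LinearMap.toContinuousLinearMap (Matrix.toEuclideanLin A)).integrable_comp hEi).add
      ((LinearMap.toContinuousLinearMap (Matrix.toEuclideanLin K)).integrable_comp
        hz_law.hasGaussianLaw.integrable)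
  have hx'_eq : x' = g + r := by
    funext s
    have := heps_x s
    simp only [Pi.add_apply, hg, hr, this]
    abel
  have hr0 : ∫ s, r s ∂μ = 0 := by
    have h := integral_map (f := fun y => y) hr_law.aemeasurable (by fun_prop)
    rw [hr_law.map_eq] at h
    rw [← h]
    exact integral_id_multivariateGaussian
  have hest : μ[x' | S'] =ᵐ[μ] g := by
    have h1 := condExp_add hgi hri S'
    have h2 : μ[r | S'] =ᵐ[μ] fun _ => ∫ s, r s ∂μ :=
      condExp_indep_eq hr_m.comap_le hS'le (comap_measurable r).stronglyMeasurable
        (hS'z ▸ hr_ind)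
    rw [hx'_eq]
    filter_upwards [h1, h2] with s hs1 hs2
    rw [hs1, Pi.add_apply, hs2, hr0, add_zero, condExp_of_stronglyMeasurable hS'le
      hgm.stronglyMeasurable hgi]
  have herr : r =ᵐ[μ] x' - μ[x' | S'] := by
    filter_upwards [hest] with s hs
    rw [Pi.sub_apply, hs, hx'_eq, Pi.add_apply, add_sub_cancel_left]
  have hinn : (fun s => Matrix.toEuclideanLin K (z s)) =ᵐ[μ]
      fun s => (μ[x' | S']) s - Matrix.toEuclideanLin A (E s) := by
    filter_upwards [hest] with s hs
    rw [hs, hg, add_sub_cancel_left]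
  have hKz : Measurable[sigmaGen z] (fun s => Matrix.toEuclideanLin K (z s)) :=
    (measurable_toEuclideanLin K).comp (comap_measurable z)
  have hlaw' : HasLaw (x' - μ[x' | S']) (multivariateGaussian 0 P') μ := hr_law.congr herr.symm
  have hind' : Indep (MeasurableSpace.comap (x' - μ[x' | S']) inferInstance) S' μ :=
    indep_comap_congr herr (hS'z ▸ hr_ind)
  have hδm : Measurable[S'] (fun s => (μ[x' | S']) s - Matrix.toEuclideanLin A (E s)) :=
    stronglyMeasurable_condExp.measurable.sub
      (hAE.mono (by rw [hS'z]; exact le_sup_right) le_rfl)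
  -- The prior error is the estimate's increment plus the new error, and these are independent.
  -- Deconvolution yields the covariance `Pm - P'` and its positivity without computing `K (C Pm Cᵀ
  -- + R) Kᵀ`.
  have hδ := hasLaw_gaussian_of_add hPmp hP'p
    (X := fun s => (μ[x' | S']) s - Matrix.toEuclideanLin A (E s)) (Y := x' - μ[x' | S'])
    (hδm.mono hS'le le_rfl).aemeasurable
    (by
      have : ((fun s => (μ[x' | S']) s - Matrix.toEuclideanLin A (E s)) + (x' - μ[x' | S'])) =
          eps := by
        funext s
        rw [heps_x, Pi.add_apply, Pi.sub_apply]
        abel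
      rw [this]
      exact heps_law) hlaw'
    ((IndepFun_iff_Indep _ _ _).2
      (indep_of_indep_of_le_right hind' hδm.comap_le).symm)
  refine ⟨P', hP'p, hlaw', hind'.symm, hδ.1, hδ.2, ?_⟩
  refine (indep_comap_congr hinn ?_).symm
  exact indep_of_indep_of_le_left
    (indep_of_indep_of_le_right hSall (hz_meas.comap_le)).symm hKz.comap_le

end kalman

end RemoteEstimation

/-! ### The plant in steady state: filtering error and innovations. -/

namespace RemoteEstimation

section plant

variable {Ω : Type*}

/-- The σ-algebra generated by `x_0`, `w_0, …, w_{k-1}` and `v_0, …, v_k`. -/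
@[reducible] def histInfo {n m : ℕ} (x₀ : Ω → EuclideanSpace ℝ (Fin n))
    (w : ℕ → Ω → EuclideanSpace ℝ (Fin n)) (v : ℕ → Ω → EuclideanSpace ℝ (Fin m)) (k : ℕ) :
    MeasurableSpace Ω :=
  sigmaGen x₀ ⊔ (⨆ j ∈ Set.Iio k, sigmaGen (w j)) ⊔ (⨆ j ∈ Set.Iic k, sigmaGen (v j))

/-- The σ-algebra generated by the whole plant randomness. -/
@[reducible] def plantInfo {n m : ℕ} (x₀ : Ω → EuclideanSpace ℝ (Fin n))
    (w : ℕ → Ω → EuclideanSpace ℝ (Fin n)) (v : ℕ → Ω → EuclideanSpace ℝ (Fin m)) :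
    MeasurableSpace Ω :=
  sigmaGen x₀ ⊔ (⨆ j, sigmaGen (w j)) ⊔ (⨆ j, sigmaGen (v j))

theorem histInfo_mono {n m : ℕ} (x₀ : Ω → EuclideanSpace ℝ (Fin n))
    (w : ℕ → Ω → EuclideanSpace ℝ (Fin n)) (v : ℕ → Ω → EuclideanSpace ℝ (Fin m)) :
    Monotone (histInfo x₀ w v) := by
  intro k l hkl
  refine sup_le_sup (sup_le_sup le_rfl ?_) ?_
  · exact biSup_mono fun j hj => lt_of_lt_of_le hj hkl
  · exact biSup_mono fun j hj => le_trans hj hkl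

theorem histInfo_le_plantInfo {n m : ℕ} (x₀ : Ω → EuclideanSpace ℝ (Fin n))
    (w : ℕ → Ω → EuclideanSpace ℝ (Fin n)) (v : ℕ → Ω → EuclideanSpace ℝ (Fin m)) (k : ℕ) :
    histInfo x₀ w v k ≤ plantInfo x₀ w v :=
  sup_le_sup (sup_le_sup le_rfl (iSup₂_le fun j _ => le_iSup (fun j => sigmaGen (w j)) j))
    (iSup₂_le fun j _ => le_iSup (fun j => sigmaGen (v j)) j)

theorem measurable_w_hist {n m : ℕ} (x₀ : Ω → EuclideanSpace ℝ (Fin n))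
    (w : ℕ → Ω → EuclideanSpace ℝ (Fin n)) (v : ℕ → Ω → EuclideanSpace ℝ (Fin m)) {j k : ℕ}
    (hjk : j < k) : Measurable[histInfo x₀ w v k] (w j) :=
  (comap_measurable (w j)).mono ((le_iSup₂ (f := fun j (_ : j ∈ Set.Iio k) => sigmaGen (w j))
    j hjk).trans (le_sup_right.trans le_sup_left)) le_rfl

theorem measurable_v_hist {n m : ℕ} (x₀ : Ω → EuclideanSpace ℝ (Fin n))
    (w : ℕ → Ω → EuclideanSpace ℝ (Fin n)) (v : ℕ → Ω → EuclideanSpace ℝ (Fin m)) {j k : ℕ}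
    (hjk : j ≤ k) : Measurable[histInfo x₀ w v k] (v j) :=
  (comap_measurable (v j)).mono ((le_iSup₂ (f := fun j (_ : j ∈ Set.Iic k) => sigmaGen (v j))
    j hjk).trans le_sup_right) le_rfl

theorem sensorInfo_succ {m : ℕ} (y : ℕ → Ω → EuclideanSpace ℝ (Fin m)) (k : ℕ) :
    sensorInfo y (k + 1) = sensorInfo y k ⊔ sigmaGen (y (k + 1)) :=
  biSup_Icc_succ _ k

variable [mΩ : MeasurableSpace Ω] {μ : Measure Ω}

/-- A linear Gaussian plant whose local Kalman filter is in steady state. -/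
structure IsSteadyPlant {n m : ℕ} (μ : Measure Ω) (A Q Pi₀ : Matrix (Fin n) (Fin n) ℝ)
    (C : Matrix (Fin m) (Fin n) ℝ) (R : Matrix (Fin m) (Fin m) ℝ)
    (x w : ℕ → Ω → EuclideanSpace ℝ (Fin n)) (y v : ℕ → Ω → EuclideanSpace ℝ (Fin m))
    (Pbar : Matrix (Fin n) (Fin n) ℝ) : Prop where
  posSemidef_Q : Q.PosSemidef
  posDef_R : R.PosDef
  posSemidef_Pi : Pi₀.PosSemidef
  state_eq : ∀ k s, x (k + 1) s = Matrix.toEuclideanLin A (x k s) + w k s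
  meas_eq : ∀ k s, y k s = Matrix.toEuclideanLin C (x k s) + v k s
  measurable_init : Measurable (x 0)
  measurable_w : ∀ k, Measurable (w k)
  measurable_v : ∀ k, Measurable (v k)
  law_init : HasLaw (x 0) (multivariateGaussian 0 Pi₀) μ
  law_w : ∀ k, HasLaw (w k) (multivariateGaussian 0 Q) μ
  law_v : ∀ k, HasLaw (v k) (multivariateGaussian 0 R) μ
  indep_w : iIndepFun w μ
  indep_v : iIndepFun v μ
  indep_wv : IndepFun (fun s k => w k s) (fun s k => v k s) μ
  indep_init : IndepFun (x 0) (fun s => ((fun k => w k s), (fun k => v k s))) μ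
  steady : ∀ k, ∀ᵐ s ∂μ, errCov μ (x k) (sensorInfo y k) s = Pbar

namespace IsSteadyPlant

variable {n m : ℕ} {A Q Pi₀ : Matrix (Fin n) (Fin n) ℝ}
    {C : Matrix (Fin m) (Fin n) ℝ} {R : Matrix (Fin m) (Fin m) ℝ}
    {x w : ℕ → Ω → EuclideanSpace ℝ (Fin n)} {y v : ℕ → Ω → EuclideanSpace ℝ (Fin m)}
    {Pbar : Matrix (Fin n) (Fin n) ℝ}

theorem indep_iSup_w_iSup_v (h : IsSteadyPlant μ A Q Pi₀ C R x w y v Pbar) :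
    Indep (⨆ j, sigmaGen (w j)) (⨆ j, sigmaGen (v j)) μ := by
  have := (IndepFun_iff_Indep _ _ _).1 h.indep_wv
  rwa [MeasurableSpace.comap_process_pi, MeasurableSpace.comap_process_pi] at this

theorem indep_noise_init (h : IsSteadyPlant μ A Q Pi₀ C R x w y v Pbar) :
    Indep ((⨆ j, sigmaGen (w j)) ⊔ ⨆ j, sigmaGen (v j)) (sigmaGen (x 0)) μ := by
  have := ((IndepFun_iff_Indep _ _ _).1 h.indep_init).symm
  have e : sigmaGen (fun s => ((fun k => w k s), (fun k => v k s))) =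
      (⨆ j, sigmaGen (w j)) ⊔ ⨆ j, sigmaGen (v j) := by
    rw [← MeasurableSpace.comap_process_pi, ← MeasurableSpace.comap_process_pi]
    exact MeasurableSpace.comap_prodMk _ _
  exact e ▸ this

theorem iSup_w_le (h : IsSteadyPlant μ A Q Pi₀ C R x w y v Pbar) : ⨆ j, sigmaGen (w j) ≤ mΩ :=
  iSup_le fun j => (h.measurable_w j).comap_le

theorem iSup_v_le (h : IsSteadyPlant μ A Q Pi₀ C R x w y v Pbar) : ⨆ j, sigmaGen (v j) ≤ mΩ :=
  iSup_le fun j => (h.measurable_v j).comap_le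

theorem plantInfo_le (h : IsSteadyPlant μ A Q Pi₀ C R x w y v Pbar) :
    plantInfo (x 0) w v ≤ mΩ :=
  sup_le (sup_le h.measurable_init.comap_le h.iSup_w_le) h.iSup_v_le

theorem histInfo_le (h : IsSteadyPlant μ A Q Pi₀ C R x w y v Pbar) (k : ℕ) :
    histInfo (x 0) w v k ≤ mΩ :=
  (histInfo_le_plantInfo _ _ _ k).trans h.plantInfo_le

/-- Starting from independence of `w k` and its predecessors, the whole process `v` and then the
initial state are joined to the past. -/
theorem indep_histInfo_w [IsProbabilityMeasure μ] (h : IsSteadyPlant μ A Q Pi₀ C R x w y v Pbar)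
    (k : ℕ) : Indep (histInfo (x 0) w v k) (sigmaGen (w k)) μ := by
  have h1 : Indep (sigmaGen (w k)) (⨆ j ∈ Set.Iio k, sigmaGen (w j)) μ := by
    have := indep_iSup_of_disjoint (S := {k}) (T := Set.Iio k)
      (fun i => (h.measurable_w i).comap_le) h.indep_w (by simp)
    simpa using this
  have hle : ⨆ j ∈ Set.Iio k, sigmaGen (w j) ≤ ⨆ j, sigmaGen (w j) :=
    iSup₂_le fun j _ => le_iSup (fun j => sigmaGen (w j)) j
  have hk : sigmaGen (w k) ≤ ⨆ j, sigmaGen (w j) := le_iSup (fun j => sigmaGen (w j)) k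
  have h2 := indep_sup_right_of_indep (hk.trans h.iSup_w_le) (hle.trans h.iSup_w_le) h.iSup_v_le
    h1 (indep_of_indep_of_le_left h.indep_iSup_w_iSup_v (sup_le hk hle))
  have h3 := indep_sup_right_of_indep (hk.trans h.iSup_w_le)
    (sup_le (hle.trans h.iSup_w_le) h.iSup_v_le) h.measurable_init.comap_le h2
    (indep_of_indep_of_le_left h.indep_noise_init
      (sup_le (hk.trans le_sup_left) (sup_le (hle.trans le_sup_left) le_sup_right)))
  refine (indep_of_indep_of_le_right h3 ?_).symm
  refine sup_le (sup_le le_sup_right (le_sup_left.trans le_sup_left)) ?_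
  exact (iSup₂_le fun j _ => le_iSup (fun j => sigmaGen (v j)) j).trans
    (le_sup_right.trans le_sup_left)

/-- The same argument with the two noises exchanged; all of `w` may be joined, so the current `w k`
is included. -/
theorem indep_histInfo_v [IsProbabilityMeasure μ] (h : IsSteadyPlant μ A Q Pi₀ C R x w y v Pbar)
    (k : ℕ) : Indep (histInfo (x 0) w v k ⊔ sigmaGen (w k)) (sigmaGen (v (k + 1))) μ := by
  have h1 : Indep (sigmaGen (v (k + 1))) (⨆ j ∈ Set.Iic k, sigmaGen (v j)) μ := by
    have := indep_iSup_of_disjoint (S := {k + 1}) (T := Set.Iic k)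
      (fun i => (h.measurable_v i).comap_le) h.indep_v (by simp)
    simpa using this
  have hle : ⨆ j ∈ Set.Iic k, sigmaGen (v j) ≤ ⨆ j, sigmaGen (v j) :=
    iSup₂_le fun j _ => le_iSup (fun j => sigmaGen (v j)) j
  have hk : sigmaGen (v (k + 1)) ≤ ⨆ j, sigmaGen (v j) :=
    le_iSup (fun j => sigmaGen (v j)) (k + 1)
  have h2 := indep_sup_right_of_indep (hk.trans h.iSup_v_le) (hle.trans h.iSup_v_le) h.iSup_w_le
    h1 (indep_of_indep_of_le_left h.indep_iSup_w_iSup_v.symm (sup_le hk hle))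
  have h3 := indep_sup_right_of_indep (hk.trans h.iSup_v_le)
    (sup_le (hle.trans h.iSup_v_le) h.iSup_w_le) h.measurable_init.comap_le h2
    (indep_of_indep_of_le_left h.indep_noise_init
      (sup_le (hk.trans le_sup_right) (sup_le (hle.trans le_sup_right) le_sup_left)))
  refine (indep_of_indep_of_le_right h3 ?_).symm
  have hw : ∀ j, sigmaGen (w j) ≤ (⨆ j ∈ Set.Iic k, sigmaGen (v j)) ⊔ (⨆ j, sigmaGen (w j)) ⊔
      sigmaGen (x 0) := fun j =>
    (le_iSup (fun j => sigmaGen (w j)) j).trans (le_sup_right.trans le_sup_left)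
  exact sup_le (sup_le (sup_le le_sup_right (iSup₂_le fun j _ => hw j))
    (le_sup_left.trans le_sup_left)) (hw k)

theorem measurable_state_hist (h : IsSteadyPlant μ A Q Pi₀ C R x w y v Pbar) (k : ℕ) :
    Measurable[histInfo (x 0) w v k] (x k) := by
  induction k with
  | zero => exact (comap_measurable (x 0)).mono (le_sup_left.trans le_sup_left) le_rfl
  | succ k ih =>
    rw [funext (h.state_eq k)]
    exact ((measurable_toEuclideanLin A).comp
      (ih.mono (histInfo_mono _ _ _ k.le_succ) le_rfl)).add
      (measurable_w_hist _ _ _ k.lt_succ_self)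

theorem measurable_meas_hist (h : IsSteadyPlant μ A Q Pi₀ C R x w y v Pbar) (k : ℕ) :
    Measurable[histInfo (x 0) w v k] (y k) := by
  rw [funext (h.meas_eq k)]
  exact ((measurable_toEuclideanLin C).comp (h.measurable_state_hist k)).add
    (measurable_v_hist _ _ _ le_rfl)

theorem sensorInfo_le_hist (h : IsSteadyPlant μ A Q Pi₀ C R x w y v Pbar) (k : ℕ) :
    sensorInfo y k ≤ histInfo (x 0) w v k :=
  iSup₂_le fun j hj => ((h.measurable_meas_hist j).mono
    (histInfo_mono _ _ _ (Finset.mem_Icc.1 hj).2) le_rfl).comap_le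

theorem sensorInfo_le (h : IsSteadyPlant μ A Q Pi₀ C R x w y v Pbar) (k : ℕ) :
    sensorInfo y k ≤ mΩ :=
  (h.sensorInfo_le_hist k).trans (h.histInfo_le k)

theorem measurable_state (h : IsSteadyPlant μ A Q Pi₀ C R x w y v Pbar) (k : ℕ) :
    Measurable (x k) :=
  (h.measurable_state_hist k).mono (h.histInfo_le k) le_rfl

theorem measurable_localEst {μ : Measure Ω} (k : ℕ) :
    Measurable[sensorInfo y k] (localEst μ x y k) :=
  stronglyMeasurable_condExp.measurable

theorem integral_err_mul_err [IsProbabilityMeasure μ]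
    (h : IsSteadyPlant μ A Q Pi₀ C R x w y v Pbar) (k : ℕ) (i j : Fin n) :
    ∫ s, (x k - localEst μ x y k) s i * (x k - localEst μ x y k) s j ∂μ = Pbar i j := by
  have h1 := integral_condExp (μ := μ) (h.sensorInfo_le k)
    (f := fun s => (x k - localEst μ x y k) s i * (x k - localEst μ x y k) s j)
  rw [← h1, integral_congr_ae (g := fun _ => Pbar i j)]
  · simp
  · filter_upwards [h.steady k] with s hs
    rw [← hs]
    rfl

/-- The estimation error of the local filter is Gaussian and independent of the measurements. -/
theorem filter_error [IsProbabilityMeasure μ] (h : IsSteadyPlant μ A Q Pi₀ C R x w y v Pbar)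
    (k : ℕ) : Pbar.PosSemidef ∧
      HasLaw (x k - localEst μ x y k) (multivariateGaussian 0 Pbar) μ ∧
      Indep (sensorInfo y k) (sigmaGen (x k - localEst μ x y k)) μ ∧
      (predCov A Q Pbar - Pbar).PosSemidef ∧
      HasLaw (fun s => localEst μ x y (k + 1) s - Matrix.toEuclideanLin A (localEst μ x y k s))
        (multivariateGaussian 0 (predCov A Q Pbar - Pbar)) μ ∧
      Indep (sensorInfo y k) (sigmaGen
        (fun s => localEst μ x y (k + 1) s - Matrix.toEuclideanLin A (localEst μ x y k s))) μ := by
  have step : ∀ k, Pbar.PosSemidef →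
      HasLaw (x k - localEst μ x y k) (multivariateGaussian 0 Pbar) μ →
      Indep (sensorInfo y k) (sigmaGen (x k - localEst μ x y k)) μ → _ :=
    fun k hP hlaw hind => by
      have hmem : Measurable[histInfo (x 0) w v k] (x k - localEst μ x y k) :=
        (h.measurable_state_hist k).sub
          ((measurable_localEst k).mono (h.sensorInfo_le_hist k) le_rfl)
      have hle : sensorInfo y k ⊔ sigmaGen (x k - localEst μ x y k) ≤ histInfo (x 0) w v k :=
        sup_le (h.sensorInfo_le_hist k) hmem.comap_le
      have := kalman_step (μ := μ) (S := sensorInfo y k) hP h.posSemidef_Q h.posDef_R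
        (h.sensorInfo_le k)
        (h.measurable_state k) (h.measurable_w k) (h.measurable_v (k + 1)) (measurable_localEst k)
        integrable_condExp (h.state_eq k) (h.meas_eq (k + 1)) hlaw (h.law_w k) (h.law_v (k + 1))
        hind (indep_of_indep_of_le_left (h.indep_histInfo_w k) hle)
        (indep_of_indep_of_le_left (h.indep_histInfo_v k)
          (by rw [← sup_assoc]; exact sup_le_sup hle le_rfl)) (sensorInfo_succ y k)
      exact this
  have main : ∀ k, Pbar.PosSemidef ∧
      HasLaw (x k - localEst μ x y k) (multivariateGaussian 0 Pbar) μ ∧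
      Indep (sensorInfo y k) (sigmaGen (x k - localEst μ x y k)) μ := by
    intro k
    induction k with
    | zero =>
      have hbot : sensorInfo y 0 = ⊥ := by simp [sensorInfo]
      have h0 : localEst μ x y 0 = fun _ => 0 := by
        rw [localEst, hbot, condExp_bot]
        funext s
        have hmap := integral_map (f := fun y => y) h.law_init.aemeasurable (by fun_prop)
        rw [h.law_init.map_eq] at hmap
        rw [← hmap]
        exact integral_id_multivariateGaussian
      have he : x 0 - localEst μ x y 0 = x 0 := by rw [h0]; exact sub_zero _
      -- Without measurements the estimate is the mean `0`, so steadiness at time `0` forces the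
      -- initial covariance to be `P̄`.
      have hP : Pi₀ = Pbar := eq_of_hasLaw_gaussian h.posSemidef_Pi (by rw [he]; exact h.law_init)
        (h.integral_err_mul_err 0)
      refine ⟨hP ▸ h.posSemidef_Pi, ?_, ?_⟩
      · rw [he, ← hP]; exact h.law_init
      · rw [hbot]; exact indep_bot_left _
    | succ k ih =>
      obtain ⟨P', hP', hlaw, hind, -⟩ := step k ih.1 ih.2.1 ih.2.2
      -- The filter step yields some covariance; steadiness pins it to `P̄`, so no Riccati equation
      -- has to be solved.
      have hP : P' = Pbar := eq_of_hasLaw_gaussian hP' hlaw (h.integral_err_mul_err (k + 1))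
      exact ⟨ih.1, hP ▸ hlaw, hind⟩
  obtain ⟨hP, hlaw, hind⟩ := main k
  obtain ⟨P', hP', hlaw', -, h4, h5, h6⟩ := step k hP hlaw hind
  have hPe : P' = Pbar := eq_of_hasLaw_gaussian hP' hlaw' (h.integral_err_mul_err (k + 1))
  rw [hPe] at h4 h5
  exact ⟨hP, hlaw, hind, h4, h5, h6⟩

end IsSteadyPlant

end plant

end RemoteEstimation

/-! ### Conditioning on channel outcomes. -/

namespace RemoteEstimation

section channel

/-- Handles quantities indexed by the random holding time and messages scaled by a random indicator.
-/
theorem measurable_comp_nat {Ω β : Type*} [MeasurableSpace Ω] [MeasurableSpace β] {N : Ω → ℕ}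
    (hN : Measurable N) {g : ℕ → Ω → β} (hg : ∀ t, Measurable (g t)) :
    Measurable (fun s => g (N s) s) := by
  intro u hu
  have : (fun s => g (N s) s) ⁻¹' u = ⋃ t, N ⁻¹' {t} ∩ g t ⁻¹' u := by
    ext s
    simp
  rw [this]
  exact MeasurableSet.iUnion fun t => (hN (measurableSet_singleton t)).inter (hg t hu)

/-- If `p` is the conditional probability of `D` given `F`, then integrating an `F`-measurable
function over `D` amounts to weighting it with `p`. -/
theorem setIntegral_eq_integral_mul_condProb {Ω : Type*} {F : MeasurableSpace Ω}
    [mΩ : MeasurableSpace Ω] {μ : Measure Ω} [IsProbabilityMeasure μ] (hF : F ≤ mΩ) {D : Set Ω}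
    (hD : MeasurableSet D) {p : Ω → ℝ}
    (hp : μ[D.indicator (fun _ => (1 : ℝ)) | F] =ᵐ[μ] p) {f : Ω → ℝ}
    (hf : StronglyMeasurable[F] f) (hfi : Integrable f μ) :
    Integrable (fun s => f s * p s) μ ∧ ∫ s in D, f s ∂μ = ∫ s, f s * p s ∂μ := by
  have hDi : Integrable (D.indicator fun _ => (1 : ℝ)) μ :=
    (integrable_const _).indicator hD
  have hfD : f * D.indicator (fun _ => (1 : ℝ)) = D.indicator f := by
    funext s
    by_cases hs : s ∈ D <;> simp [hs]
  have hfDi : Integrable (f * D.indicator fun _ => (1 : ℝ)) μ := hfD ▸ hfi.indicator hD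
  have h1 := condExp_mul_of_stronglyMeasurable_left hf hfDi hDi
  have h2 : μ[f * D.indicator (fun _ => (1 : ℝ)) | F] =ᵐ[μ] fun s => f s * p s := by
    filter_upwards [h1, hp] with s hs1 hs2
    rw [hs1, Pi.mul_apply, hs2]
  refine ⟨integrable_condExp.congr h2, ?_⟩
  rw [← integral_congr_ae h2, integral_condExp hF, hfD, integral_indicator hD]

/-- Propagation of a conditional independence property: `Z` and `B` are conditionally independent
given `S`, for all `G`-measurable `Z`, and this remains true when `S` grows inside `G` and `B` is
enlarged by an event whose conditional probability given `G ⊔ B` does not involve `G`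
beyond `S'`. -/
theorem condExp_sup_eq_step {Ω : Type*} {S S' B B' G : MeasurableSpace Ω}
    [mΩ : MeasurableSpace Ω] {μ : Measure Ω} [IsProbabilityMeasure μ] (hSS' : S ≤ S')
    (hS'G : S' ≤ G) (hG : G ≤ mΩ) (hB : B ≤ mΩ) (hB' : B' ≤ mΩ) {D : Set Ω}
    (hD : MeasurableSet D)
    (hB'D : ∀ b, MeasurableSet[B'] b → b = ∅ ∨ b = Set.univ ∨ b = D ∨ b = Dᶜ)
    {p : Ω → ℝ} (hpm : Measurable[S' ⊔ B] p)
    (hp : μ[D.indicator (fun _ => (1 : ℝ)) | G ⊔ B] =ᵐ[μ] p)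
    (h : ∀ Z : Ω → ℝ, Measurable[G] Z → Integrable Z μ → μ[Z | S ⊔ B] =ᵐ[μ] μ[Z | S])
    (Z : Ω → ℝ) (hZ : Measurable[G] Z) (hZi : Integrable Z μ) :
    μ[Z | S' ⊔ B ⊔ B'] =ᵐ[μ] μ[Z | S'] := by
  have hS' : S' ≤ mΩ := hS'G.trans hG
  have hK' : S' ⊔ B ≤ mΩ := sup_le hS' hB
  have hgm : StronglyMeasurable[S'] (μ[Z | S']) := stronglyMeasurable_condExp
  have hgi : Integrable (μ[Z | S']) μ := integrable_condExp
  -- first enlarge `S`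
  have h1 : μ[Z | S'] =ᵐ[μ] μ[Z | S' ⊔ B] := by
    refine ae_eq_condExp_sup hS' hB hZi hgi (hgm.mono le_sup_left) fun a b ha hb => ?_
    have ha' : MeasurableSet a := hS' _ ha
    have hb' : MeasurableSet[S ⊔ B] b := le_sup_right (a := S) _ hb
    have hSB : S ⊔ B ≤ mΩ := sup_le (hSS'.trans hS') hB
    -- The hypothesis is applied to `Z` and to `μ[Z | S']`, both cut down to `a`. Since `a` lies in
    -- `S' ≤ G` this is allowed, and the tower property makes their projections on `S` agree.
    have e1 := h (a.indicator Z) (hZ.indicator (hS'G _ ha)) (hZi.indicator ha')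
    have e2 := h (a.indicator (μ[Z | S']))
      ((hgm.measurable.mono hS'G le_rfl).indicator (hS'G _ ha)) (hgi.indicator ha')
    have e3 : μ[a.indicator Z | S] =ᵐ[μ] μ[a.indicator (μ[Z | S']) | S] :=
      (condExp_condExp_of_le hSS' hS').symm.trans
        (condExp_congr_ae (condExp_indicator hZi ha))
    have key : ∫ s in b, a.indicator (μ[Z | S']) s ∂μ = ∫ s in b, a.indicator Z s ∂μ := by
      rw [← setIntegral_condExp hSB (hgi.indicator ha') hb',
        ← setIntegral_condExp hSB (hZi.indicator ha') hb']
      exact setIntegral_congr_ae (hSB _ hb') (by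
        filter_upwards [e1, e2, e3] with s hs1 hs2 hs3 _
        rw [hs1, hs2, hs3])
    rwa [setIntegral_indicator ha', setIntegral_indicator ha', Set.inter_comm] at key
  -- then enlarge `B`
  refine (ae_eq_condExp_sup hK' hB' hZi hgi (hgm.mono (le_sup_left.trans le_sup_left))
    fun a b ha hb => ?_).symm
  have ha' : MeasurableSet a := hK' _ ha
  have haF : MeasurableSet[G ⊔ B] a := sup_le_sup hS'G le_rfl _ ha
  have hGB : G ⊔ B ≤ mΩ := sup_le hG hB
  have hA : ∫ s in a, (μ[Z | S']) s ∂μ = ∫ s in a, Z s ∂μ := by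
    rw [← setIntegral_condExp hK' hZi ha]
    exact setIntegral_congr_ae ha' (h1.mono fun s hs _ => hs)
  -- Integrating over `D` means weighting with `p`. As `p` is measurable for `S' ⊔ B`, the variable
  -- `Z` may be projected on that σ-algebra, where `h1` gives `μ[Z | S']`.
  have hAD : ∫ s in a ∩ D, (μ[Z | S']) s ∂μ = ∫ s in a ∩ D, Z s ∂μ := by
    have i1 := setIntegral_eq_integral_mul_condProb hGB hD hp (f := a.indicator (μ[Z | S']))
      (((hgm.mono hS'G).mono le_sup_left).indicator haF) (hgi.indicator ha')
    have i2 := setIntegral_eq_integral_mul_condProb hGB hD hp (f := a.indicator Z)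
      ((hZ.stronglyMeasurable.mono le_sup_left).indicator haF) (hZi.indicator ha')
    rw [setIntegral_indicator ha', Set.inter_comm] at i1 i2
    rw [i1.2, i2.2]
    have e : ∀ f : Ω → ℝ, (fun s => a.indicator f s * p s) = a.indicator p * f := by
      intro f
      funext s
      by_cases hs : s ∈ a <;> simp [hs, mul_comm]
    have hpa : StronglyMeasurable[S' ⊔ B] (a.indicator p) :=
      (hpm.indicator ha).stronglyMeasurable
    have c := condExp_mul_of_stronglyMeasurable_left hpa (e Z ▸ i2.1) hZi
    rw [e, e, ← integral_condExp hK' (f := a.indicator p * Z)]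
    refine integral_congr_ae ?_
    filter_upwards [c, h1] with s hs1 hs2
    rw [hs1, Pi.mul_apply, Pi.mul_apply, hs2]
  rcases hB'D b hb with rfl | rfl | rfl | rfl
  · simp
  · simpa using hA
  · exact hAD
  · have j1 := integral_inter_add_sdiff hD (hgi.integrableOn (s := a))
    have j2 := integral_inter_add_sdiff hD (hZi.integrableOn (s := a))
    rw [Set.sdiff_eq] at j1 j2
    linarith

end channel

end RemoteEstimation

/-! ### Independence and laws under restriction to an event. -/

namespace RemoteEstimation

section general

/-- If conditioning on `B` in addition to `S` does not change the conditional expectation of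
`G`-measurable variables, then independence of `S` extends to `S ⊔ B`. -/
theorem indep_sup_of_condExp_eq {Ω : Type*} {S B G M : MeasurableSpace Ω}
    [mΩ : MeasurableSpace Ω] {μ : Measure Ω} [IsProbabilityMeasure μ] (hS : S ≤ mΩ) (hB : B ≤ mΩ)
    (hM : M ≤ G) (hG : G ≤ mΩ)
    (h : ∀ Z : Ω → ℝ, Measurable[G] Z → Integrable Z μ → μ[Z | S ⊔ B] =ᵐ[μ] μ[Z | S])
    (hind : Indep S M μ) : Indep (S ⊔ B) M μ := by
  rw [Indep_iff]
  intro a b ha hb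
  have hSB : S ⊔ B ≤ mΩ := sup_le hS hB
  have hb' : MeasurableSet b := hG _ (hM _ hb)
  have hi : Integrable (b.indicator fun _ => (1 : ℝ)) μ := (integrable_const _).indicator hb'
  have h1 := h (b.indicator fun _ => (1 : ℝ)) (measurable_const.indicator (hM _ hb)) hi
  have h2 : μ[b.indicator (fun _ => (1 : ℝ)) | S] =ᵐ[μ]
      fun _ => ∫ s, b.indicator (fun _ => (1 : ℝ)) s ∂μ :=
    condExp_indep_eq (hM.trans hG) hS
      (Measurable.stronglyMeasurable (measurable_const.indicator hb)) hind.symm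
  have h3 : ∫ s in a, b.indicator (fun _ => (1 : ℝ)) s ∂μ =
      ∫ s in a, (∫ s, b.indicator (fun _ => (1 : ℝ)) s ∂μ) ∂μ := by
    rw [← setIntegral_condExp hSB hi ha]
    exact setIntegral_congr_ae (hSB _ ha) (by
      filter_upwards [h1, h2] with s hs1 hs2 _
      rw [hs1, hs2])
  rw [setIntegral_indicator hb', integral_indicator hb', setIntegral_const, setIntegral_const,
    setIntegral_const, smul_eq_mul, smul_eq_mul, smul_eq_mul, mul_one, mul_one] at h3
  rwa [measureReal_def, measureReal_def, measureReal_def, ← ENNReal.toReal_mul,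
    ENNReal.toReal_eq_toReal_iff' (measure_ne_top _ _)
      (ENNReal.mul_ne_top (measure_ne_top _ _) (measure_ne_top _ _))] at h3

/-- Adding independent Gaussian noise to a linear image of a (restricted) Gaussian variable. -/
theorem map_restrict_gaussian_add {Ω : Type*} {K : MeasurableSpace Ω} [mΩ : MeasurableSpace Ω]
    {μ : Measure Ω} [IsProbabilityMeasure μ] {n : ℕ} {S T : Matrix (Fin n) (Fin n) ℝ}
    (hS : S.PosSemidef) (hT : T.PosSemidef) (hK : K ≤ mΩ) {D : Set Ω} (hD : MeasurableSet[K] D)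
    {X Y : Ω → EuclideanSpace ℝ (Fin n)} (hX : Measurable[K] X) (hYm : Measurable Y)
    (hind : Indep K (sigmaGen Y) μ) {c : ENNReal}
    (hlaw : (μ.restrict D).map X = c • multivariateGaussian 0 S)
    (hY : HasLaw Y (multivariateGaussian 0 T) μ) (A : Matrix (Fin n) (Fin n) ℝ) :
    (μ.restrict D).map (fun s => Matrix.toEuclideanLin A (X s) + Y s) =
      c • multivariateGaussian 0 (A * S * Aᵀ + T) := by
  have hXm : Measurable X := hX.mono hK le_rfl
  -- Since `D` lies in `K`, the sets `X ⁻¹' a ∩ D` remain independent of `Y`, so the restricted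
  -- joint law is still a product.
  have hjoint : (μ.restrict D).map (fun s => (X s, Y s)) =
      (c • multivariateGaussian 0 S).prod (multivariateGaussian 0 T) := by
    rw [← hlaw, ← hY.map_eq]
    refine (Measure.prod_eq fun a b ha hb => ?_).symm
    rw [Measure.map_apply (hXm.prodMk hYm) (ha.prod hb), Measure.map_apply hXm ha,
      Measure.map_apply hYm hb, Measure.restrict_apply (hXm ha),
      Measure.restrict_apply ((hXm.prodMk hYm) (ha.prod hb))]
    rw [Indep_iff] at hind
    rw [← hind _ _ ((hX ha).inter hD) ⟨b, hb, rfl⟩]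
    congr 1
    ext s
    simp only [Set.mem_inter_iff, Set.mem_preimage, Set.mem_prod]
    tauto
  have hA := measurable_toEuclideanLin A
  have hg : Measurable (fun p : EuclideanSpace ℝ (Fin n) × EuclideanSpace ℝ (Fin n) =>
      Matrix.toEuclideanLin A p.1 + p.2) := (hA.comp measurable_fst).add measurable_snd
  have h := hasLaw_gaussian_add
    (μ := (multivariateGaussian 0 S).prod (multivariateGaussian 0 T)) hS hT
    (X := Prod.fst) (Y := Prod.snd) ⟨measurable_fst.aemeasurable, measurePreserving_fst.map_eq⟩
    ⟨measurable_snd.aemeasurable, measurePreserving_snd.map_eq⟩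
    (indepFun_prod (X := id) (Y := id) measurable_id measurable_id) A 1
  have one : ∀ u : EuclideanSpace ℝ (Fin n),
      Matrix.toEuclideanLin (1 : Matrix (Fin n) (Fin n) ℝ) u = u := by
    intro u; ext1; simp
  simp only [one, Matrix.one_mul, Matrix.transpose_one, Matrix.mul_one] at h
  rw [show (fun s => Matrix.toEuclideanLin A (X s) + Y s) =
    (fun p : EuclideanSpace ℝ (Fin n) × EuclideanSpace ℝ (Fin n) =>
      Matrix.toEuclideanLin A p.1 + p.2) ∘ fun s => (X s, Y s) from rfl,
    ← Measure.map_map hg (hXm.prodMk hYm), hjoint, Measure.prod_smul_left, Measure.map_smul,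
    h.map_eq]

/-- Restricting to an event `D₀` whose conditional probability is a function `φ` of `X` multiplies
the law of `X` by the density `φ`. -/
theorem map_restrict_inter_eq_withDensity {Ω E : Type*} {F : MeasurableSpace Ω}
    [mΩ : MeasurableSpace Ω] [MeasurableSpace E]
    {μ : Measure Ω} [IsProbabilityMeasure μ] (hF : F ≤ mΩ) {D D₀ : Set Ω}
    (hD : MeasurableSet[F] D) (hD₀ : MeasurableSet D₀) {p : Ω → ℝ}
    (hp : μ[D₀.indicator (fun _ => (1 : ℝ)) | F] =ᵐ[μ] p) {X : Ω → E} (hX : Measurable[F] X)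
    {φ : E → ℝ} (hφ : Measurable φ) (hφ0 : ∀ x, 0 ≤ φ x) (hpφ : ∀ s ∈ D, p s = φ (X s)) :
    (μ.restrict (D ∩ D₀)).map X =
      ((μ.restrict D).map X).withDensity (fun x => ENNReal.ofReal (φ x)) := by
  have hXm : Measurable X := hX.mono hF le_rfl
  ext a ha
  have haD : MeasurableSet[F] (X ⁻¹' a ∩ D) := (hX ha).inter hD
  have haD' : MeasurableSet (X ⁻¹' a ∩ D) := hF _ haD
  obtain ⟨hi, he⟩ := setIntegral_eq_integral_mul_condProb hF hD₀ hp
    (f := (X ⁻¹' a ∩ D).indicator fun _ => (1 : ℝ))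
    ((measurable_const.indicator haD).stronglyMeasurable)
    ((integrable_const _).indicator haD')
  have e1 : (fun s => (X ⁻¹' a ∩ D).indicator (fun _ => (1 : ℝ)) s * p s) =
      (X ⁻¹' a ∩ D).indicator (fun s => φ (X s)) := by
    funext s
    by_cases hs : s ∈ X ⁻¹' a ∩ D
    · simp [hs, hpφ s hs.2]
    · simp [hs]
  rw [e1] at hi he
  rw [setIntegral_indicator haD', setIntegral_const, smul_eq_mul, mul_one,
    integral_indicator haD'] at he
  rw [integrable_indicator_iff haD'] at hi
  rw [withDensity_apply _ ha, setLIntegral_map ha (by fun_prop) hXm,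
    Measure.restrict_restrict (hXm ha), Measure.map_apply hXm ha,
    Measure.restrict_apply (hXm ha),
    ← ofReal_integral_eq_lintegral_ofReal hi (Filter.Eventually.of_forall fun s => hφ0 _), ← he,
    measureReal_def, ENNReal.ofReal_toReal (measure_ne_top _ _), ← Set.inter_assoc, Set.inter_comm]

end general

/-! ### The event-triggered channel. -/

section channel

variable {Ω : Type*}

/-- The σ-algebra generated by the arrival indicators `γ_1, …, γ_k`. -/
@[reducible] def channelInfo (γ : ℕ → Ω → ℕ) (k : ℕ) : MeasurableSpace Ω :=
  ⨆ j ∈ Finset.Icc 1 k, sigmaGen (γ j)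

theorem channelInfo_succ (γ : ℕ → Ω → ℕ) (k : ℕ) :
    channelInfo γ (k + 1) = channelInfo γ k ⊔ sigmaGen (γ (k + 1)) :=
  biSup_Icc_succ _ k

theorem channelInfo_mono (γ : ℕ → Ω → ℕ) : Monotone (channelInfo γ) := fun _ _ hkl =>
  biSup_mono fun _ hj => Finset.mem_Icc.2
    ⟨(Finset.mem_Icc.1 hj).1, (Finset.mem_Icc.1 hj).2.trans hkl⟩

theorem sensorInfo_mono {m : ℕ} (y : ℕ → Ω → EuclideanSpace ℝ (Fin m)) :
    Monotone (sensorInfo y) := fun _ _ hkl =>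
  biSup_mono fun _ hj => Finset.mem_Icc.2
    ⟨(Finset.mem_Icc.1 hj).1, (Finset.mem_Icc.1 hj).2.trans hkl⟩

theorem measurable_channelInfo (γ : ℕ → Ω → ℕ) {j k : ℕ} (hj : 1 ≤ j) (hjk : j ≤ k) :
    Measurable[channelInfo γ k] (γ j) :=
  (comap_measurable (γ j)).mono (le_iSup₂ (f := fun j (_ : j ∈ Finset.Icc 1 k) => sigmaGen (γ j))
    j (Finset.mem_Icc.2 ⟨hj, hjk⟩)) le_rfl

variable [mΩ : MeasurableSpace Ω] {μ : Measure Ω}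

/-- A channel whose packet drop probabilities are controlled by the data-driven power. -/
structure IsEventChannel {n m : ℕ} (μ : Measure Ω) (N₀ W α base : ℝ)
    (wt : ℕ → Matrix (Fin n) (Fin n) ℝ) (A : Matrix (Fin n) (Fin n) ℝ)
    (x₀ : Ω → EuclideanSpace ℝ (Fin n)) (w : ℕ → Ω → EuclideanSpace ℝ (Fin n))
    (v : ℕ → Ω → EuclideanSpace ℝ (Fin m)) (xs : ℕ → Ω → EuclideanSpace ℝ (Fin n))
    (γ : ℕ → Ω → ℕ) : Prop where
  measurable : ∀ k, Measurable (γ k)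
  zero_or_one : ∀ k s, γ k s = 0 ∨ γ k s = 1
  init : ∀ s, γ 0 s = 1
  drop : ∀ k, 1 ≤ k →
      μ[Set.indicator {s | γ k s = 0} (fun _ => (1 : ℝ)) | plantAndPast x₀ w v γ k]
        =ᵐ[μ] fun s => Real.exp (-α / (N₀ * W)) ^ power N₀ W α base wt A γ xs k s

namespace IsEventChannel

variable {n m : ℕ} {A Q Pi₀ : Matrix (Fin n) (Fin n) ℝ}
    {C : Matrix (Fin m) (Fin n) ℝ} {R : Matrix (Fin m) (Fin m) ℝ}
    {x w : ℕ → Ω → EuclideanSpace ℝ (Fin n)} {y v : ℕ → Ω → EuclideanSpace ℝ (Fin m)}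
    {Pbar : Matrix (Fin n) (Fin n) ℝ} {N₀ W α base : ℝ} {wt : ℕ → Matrix (Fin n) (Fin n) ℝ}
    {x₀ : Ω → EuclideanSpace ℝ (Fin n)} {xs : ℕ → Ω → EuclideanSpace ℝ (Fin n)} {γ : ℕ → Ω → ℕ}

theorem channelInfo_le (hc : IsEventChannel μ N₀ W α base wt A x₀ w v xs γ) (k : ℕ) :
    channelInfo γ k ≤ mΩ :=
  iSup₂_le fun j _ => (hc.measurable j).comap_le

theorem measurable_indicator (hc : IsEventChannel μ N₀ W α base wt A x₀ w v xs γ) {j k : ℕ}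
    (hjk : j ≤ k) : Measurable[channelInfo γ k] (γ j) := by
  rcases Nat.eq_zero_or_pos j with rfl | hj
  · rw [funext hc.init]
    exact measurable_const
  · exact measurable_channelInfo γ hj hjk

/-- The holding time at `k + 1` looks only at arrivals up to time `k`, hence the index shift. -/
theorem measurable_holdTime (hc : IsEventChannel μ N₀ W α base wt A x₀ w v xs γ) (k : ℕ) :
    Measurable[channelInfo γ k] (holdTime γ (k + 1)) := by
  have h : Measurable[channelInfo γ k] (fun s => Nat.findGreatest (fun t => γ t s = 1) k) :=
    @measurable_findGreatest Ω (channelInfo γ k) (fun s t => γ t s = 1) _ k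
      fun t ht => hc.measurable_indicator ht (measurableSet_singleton 1)
  exact (measurable_from_top (f := fun i : ℕ => k + 1 - i)).comp h

/-- Together with the drop law, this shows that the chance of a drop depends on the plant only
through the measurements, as `condExp_sup_eq_step` requires. -/
theorem measurable_power (hc : IsEventChannel μ N₀ W α base wt A x₀ w v (localEst μ x y) γ)
    (k : ℕ) : Measurable[sensorInfo y (k + 1) ⊔ channelInfo γ k]
      (power N₀ W α base wt A γ (localEst μ x y) (k + 1)) := by
  have hxs : ∀ j, j ≤ k + 1 → Measurable[sensorInfo y (k + 1) ⊔ channelInfo γ k]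
      (localEst μ x y j) := fun j hj =>
    (IsSteadyPlant.measurable_localEst j).mono ((sensorInfo_mono y hj).trans le_sup_left) le_rfl
  refine @measurable_comp_nat Ω ℝ (sensorInfo y (k + 1) ⊔ channelInfo γ k) _
    (holdTime γ (k + 1)) ((hc.measurable_holdTime k).mono le_sup_right le_rfl)
    (fun t s => N₀ * W / (2 * α) *
      ((localEst μ x y (k + 1) s - Matrix.toEuclideanLin (A ^ t)
          (localEst μ x y (k + 1 - t) s)).ofLp ⬝ᵥ
        (wt t *ᵥ (localEst μ x y (k + 1) s - Matrix.toEuclideanLin (A ^ t)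
          (localEst μ x y (k + 1 - t) s)).ofLp)) + base) fun t => ?_
  have hq : Measurable (fun z : EuclideanSpace ℝ (Fin n) =>
      N₀ * W / (2 * α) * (z.ofLp ⬝ᵥ (wt t *ᵥ z.ofLp)) + base) := by
    have : Continuous (fun z : EuclideanSpace ℝ (Fin n) => z.ofLp ⬝ᵥ (wt t *ᵥ z.ofLp)) := by
      fun_prop
    fun_prop
  exact hq.comp ((hxs _ le_rfl).sub
    ((measurable_toEuclideanLin (A ^ t)).comp (hxs _ (Nat.sub_le _ _))))

/-- Given the measurements, the channel carries no further information on the plant. -/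
theorem condExp_sensorInfo_sup_channelInfo [IsProbabilityMeasure μ]
    (h : IsSteadyPlant μ A Q Pi₀ C R x w y v Pbar)
    (hc : IsEventChannel μ N₀ W α base wt A (x 0) w v (localEst μ x y) γ) (k : ℕ) :
    ∀ Z : Ω → ℝ, Measurable[plantInfo (x 0) w v] Z → Integrable Z μ →
      μ[Z | sensorInfo y k ⊔ channelInfo γ k] =ᵐ[μ] μ[Z | sensorInfo y k] := by
  induction k with
  | zero =>
    intro Z _ _
    have : channelInfo γ 0 = ⊥ := by simp [channelInfo]
    rw [this, sup_bot_eq]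
  | succ k ih =>
    intro Z hZ hZi
    have hD : MeasurableSet {s | γ (k + 1) s = 0} := hc.measurable _ (measurableSet_singleton 0)
    have := condExp_sup_eq_step (sensorInfo_mono y k.le_succ)
      ((h.sensorInfo_le_hist (k + 1)).trans (histInfo_le_plantInfo _ _ _ _)) h.plantInfo_le
      (hc.channelInfo_le k) (hc.measurable (k + 1)).comap_le hD ?_
      (measurable_const.pow (hc.measurable_power k)) (hc.drop (k + 1) (by omega)) ih Z hZ hZi
    · rwa [sup_assoc, ← channelInfo_succ] at this
    -- A two-valued indicator generates only the four sets determined by whether `T` contains `0`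
    -- and `1`.
    · rintro _ ⟨T, -, rfl⟩
      by_cases h0 : 0 ∈ T <;> by_cases h1 : 1 ∈ T
      · right; left
        ext s
        rcases hc.zero_or_one (k + 1) s with hs | hs <;> simp [hs, h0, h1]
      · right; right; left
        ext s
        rcases hc.zero_or_one (k + 1) s with hs | hs <;> simp [hs, h0, h1]
      · right; right; right
        ext s
        rcases hc.zero_or_one (k + 1) s with hs | hs <;> simp [hs, h0, h1]
      · left
        ext s
        rcases hc.zero_or_one (k + 1) s with hs | hs <;> simp [hs, h0, h1]

end IsEventChannel

end channel

end RemoteEstimation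

/-! ### The law of the accumulated innovation during a run of drops. -/

namespace RemoteEstimation

section tilted

variable {Ω : Type*}

/-- The event that no packet arrives at the times `t + 1, …, t + i`. -/
def dropEvent (γ : ℕ → Ω → ℕ) (t i : ℕ) : Set Ω := {s | ∀ j, t < j → j ≤ t + i → γ j s = 0}

theorem dropEvent_succ (γ : ℕ → Ω → ℕ) (t i : ℕ) :
    dropEvent γ t (i + 1) = dropEvent γ t i ∩ {s | γ (t + i + 1) s = 0} := by
  ext s
  constructor
  · exact fun hs => ⟨fun j h1 h2 => hs j h1 (by omega), hs _ (by omega) (by omega)⟩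
  · rintro ⟨h1, h2⟩ j hj hj'
    rcases Nat.lt_or_ge (t + i) j with hlt | hge
    · obtain rfl : j = t + i + 1 := by omega
      exact h2
    · exact h1 j hj hge

theorem measurableSet_dropEvent (γ : ℕ → Ω → ℕ) (t i : ℕ) :
    MeasurableSet[channelInfo γ (t + i)] (dropEvent γ t i) := by
  have : dropEvent γ t i = ⋂ j ∈ Set.Ioc t (t + i), γ j ⁻¹' {0} := by
    ext s
    simp [dropEvent]
  rw [this]
  exact MeasurableSet.biInter (Set.to_countable _) fun j hj =>
    measurable_channelInfo γ (by have := hj.1; omega) hj.2 (measurableSet_singleton 0)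

theorem holdTime_eq {γ : ℕ → Ω → ℕ} {t i : ℕ} {s : Ω} (h1 : γ t s = 1) (hs : s ∈ dropEvent γ t i) :
    holdTime γ (t + i + 1) s = i + 1 := by
  have : Nat.findGreatest (fun t => γ t s = 1) (t + i) = t := by
    rw [Nat.findGreatest_eq_iff]
    refine ⟨by omega, fun _ => h1, fun j hj hj' => ?_⟩
    rw [hs j hj hj']
    exact zero_ne_one
  simp only [holdTime, Nat.add_sub_cancel, this]
  omega

variable [mΩ : MeasurableSpace Ω] {μ : Measure Ω}

variable {n m : ℕ} {A Q Pi₀ : Matrix (Fin n) (Fin n) ℝ}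
    {C : Matrix (Fin m) (Fin n) ℝ} {R : Matrix (Fin m) (Fin m) ℝ}
    {x w : ℕ → Ω → EuclideanSpace ℝ (Fin n)} {y v : ℕ → Ω → EuclideanSpace ℝ (Fin m)}
    {Pbar : Matrix (Fin n) (Fin n) ℝ} {N₀ W α base : ℝ} {wt : ℕ → Matrix (Fin n) (Fin n) ℝ}
    {γ : ℕ → Ω → ℕ}

theorem posSemidef_Psi (hS : (predCov A Q Pbar - Pbar).PosSemidef)
    (hwt : ∀ τ, 1 ≤ τ → (wt τ).PosSemidef) (τ : ℕ) : (Psi A Q Pbar wt τ).PosSemidef := by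
  induction τ with
  | zero => exact Matrix.PosSemidef.zero
  | succ τ ih =>
    refine posSemidef_pinv ((hwt _ (by omega)).add (posSemidef_pinv (Matrix.PosSemidef.add ?_ hS)))
    simpa using ih.mul_mul_conjTranspose_same A

/-- On the event that the last packet arrived at time `t` and the next `i` ones are dropped, the
innovation accumulated since time `t` is, up to normalisation, Gaussian with covariance `Ψ_i`. -/
theorem exists_map_restrict_innovation [IsProbabilityMeasure μ]
    (h : IsSteadyPlant μ A Q Pi₀ C R x w y v Pbar)
    (hc : IsEventChannel μ N₀ W α base wt A (x 0) w v (localEst μ x y) γ)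
    (hN₀ : 0 < N₀) (hW : 0 < W) (hα : 0 < α) (hwt : ∀ τ, 1 ≤ τ → (wt τ).PosSemidef)
    (hSigPsi : ∀ τ, 1 ≤ τ → (Sig A Q Pbar wt τ - Psi A Q Pbar wt τ).PosSemidef)
    {t : ℕ} {B : Set Ω} (hB : MeasurableSet[sensorInfo y t ⊔ channelInfo γ t] B)
    (hBt : ∀ s ∈ B, γ t s = 1) (i : ℕ) :
    ∃ c : ENNReal, (μ.restrict (B ∩ dropEvent γ t i)).map
        (fun s => localEst μ x y (t + i) s - Matrix.toEuclideanLin (A ^ i) (localEst μ x y t s)) =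
      c • multivariateGaussian 0 (Psi A Q Pbar wt i) := by
  have hS1 : (predCov A Q Pbar - Pbar).PosSemidef := (h.filter_error 0).2.2.2.1
  have hK : ∀ k, sensorInfo y k ⊔ channelInfo γ k ≤ mΩ := fun k =>
    sup_le (h.sensorInfo_le k) (hc.channelInfo_le k)
  have hSG : ∀ k, sensorInfo y k ≤ plantInfo (x 0) w v := fun k =>
    (h.sensorInfo_le_hist k).trans (histInfo_le_plantInfo _ _ _ _)
  have hest : ∀ k l, k ≤ l → Measurable[sensorInfo y l] (localEst μ x y k) := fun k l hkl =>
    (IsSteadyPlant.measurable_localEst k).mono (sensorInfo_mono y hkl) le_rfl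
  have hinn : ∀ i, Measurable[sensorInfo y (t + i)]
      (fun s => localEst μ x y (t + i) s -
        Matrix.toEuclideanLin (A ^ i) (localEst μ x y t s)) := fun i =>
    (hest _ _ le_rfl).sub ((measurable_toEuclideanLin _).comp (hest _ _ (by omega)))
  have hD : ∀ i, MeasurableSet[sensorInfo y (t + i) ⊔ channelInfo γ (t + i)]
      (B ∩ dropEvent γ t i) := fun i =>
    MeasurableSet.inter (sup_le_sup (sensorInfo_mono y (by omega))
      (channelInfo_mono γ (by omega)) _ hB)
      (le_sup_right (a := sensorInfo y (t + i)) _ (measurableSet_dropEvent γ t i))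
  induction i with
  | zero =>
    -- The accumulated innovation is `0` just after an arrival, so its law is a Dirac mass, that is,
    -- the Gaussian with covariance `Ψ_0 = 0`, scaled by the mass of the event.
    refine ⟨μ.restrict (B ∩ dropEvent γ t 0) Set.univ, ?_⟩
    have : (fun s => localEst μ x y (t + 0) s -
        Matrix.toEuclideanLin (A ^ 0) (localEst μ x y t s)) = fun _ => 0 := by
      funext s
      ext1
      simp
    rw [this, Measure.map_const]
    exact congrArg _ multivariateGaussian_zero_zero.symm
  | succ i ih =>
    obtain ⟨c, hc'⟩ := ih
    set k := t + i with hk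
    obtain ⟨-, -, -, -, hδ, hδind⟩ := h.filter_error k
    set δ := fun s => localEst μ x y (k + 1) s - Matrix.toEuclideanLin A (localEst μ x y k s)
      with hδdef
    have hδm : Measurable[sensorInfo y (k + 1)] δ :=
      (hest _ _ le_rfl).sub ((measurable_toEuclideanLin _).comp (hest _ _ (by omega)))
    have hind : Indep (sensorInfo y k ⊔ channelInfo γ k) (sigmaGen δ) μ :=
      indep_sup_of_condExp_eq (h.sensorInfo_le k) (hc.channelInfo_le k)
        (hδm.comap_le.trans (hSG _)) h.plantInfo_le
        (hc.condExp_sensorInfo_sup_channelInfo h k) hδind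
    have hPsi := posSemidef_Psi hS1 hwt i
    have hstep := map_restrict_gaussian_add hPsi hS1 (hK k) (hD i)
      ((hinn i).mono le_sup_left le_rfl) (hδm.mono (h.sensorInfo_le _) le_rfl) hind hc' hδ A
    have hη : (fun s => Matrix.toEuclideanLin A (localEst μ x y k s -
        Matrix.toEuclideanLin (A ^ i) (localEst μ x y t s)) + δ s) =
        fun s => localEst μ x y (k + 1) s -
          Matrix.toEuclideanLin (A ^ (i + 1)) (localEst μ x y t s) := by
      funext s
      have : Matrix.toEuclideanLin (A ^ (i + 1)) (localEst μ x y t s) =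
          Matrix.toEuclideanLin A (Matrix.toEuclideanLin (A ^ i) (localEst μ x y t s)) := by
        ext1
        simp only [Matrix.ofLp_toLpLin, Matrix.toLin'_apply, Matrix.mulVec_mulVec, pow_succ']
      rw [this, map_sub, hδdef]
      exact sub_add_sub_cancel' _ _ _
    rw [hη] at hstep
    have hSig : A * Psi A Q Pbar wt i * Aᵀ + (predCov A Q Pbar - Pbar) =
        Sig A Q Pbar wt (i + 1) := rfl
    rw [hSig] at hstep
    have hSigp : (Sig A Q Pbar wt (i + 1)).PosSemidef := by
      rw [← hSig]
      exact Matrix.PosSemidef.add (by simpa using hPsi.mul_mul_conjTranspose_same A) hS1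
    -- This is `q ^ ω_k` as a function of the innovation: the factor `N₀ W / (2 α)` in the power
    -- cancels against `q = exp (-α / (N₀ W))` and leaves the exponent `-1/2`; `base` contributes
    -- only a constant.
    set φ : EuclideanSpace ℝ (Fin n) → ℝ := fun z =>
      Real.exp (-(α / (N₀ * W) * base)) * Real.exp (-(1 / 2) * (z.ofLp ⬝ᵥ wt (i + 1) *ᵥ z.ofLp))
      with hφ
    have hq : Measurable (fun z : EuclideanSpace ℝ (Fin n) =>
        Real.exp (-(1 / 2) * (z.ofLp ⬝ᵥ wt (i + 1) *ᵥ z.ofLp))) := by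
      have : Continuous (fun z : EuclideanSpace ℝ (Fin n) => z.ofLp ⬝ᵥ wt (i + 1) *ᵥ z.ofLp) := by
        fun_prop
      fun_prop
    have hF : plantAndPast (x 0) w v γ (k + 1) ≤ mΩ :=
      sup_le h.plantInfo_le (hc.channelInfo_le k)
    have hKF : sensorInfo y k ⊔ channelInfo γ k ≤ plantAndPast (x 0) w v γ (k + 1) :=
      sup_le_sup (hSG k) le_rfl
    have hden := map_restrict_inter_eq_withDensity hF (hKF _ (hD i))
      (hc.measurable (k + 1) (measurableSet_singleton 0)) (hc.drop (k + 1) (by omega))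
      (X := fun s => localEst μ x y (k + 1) s -
          Matrix.toEuclideanLin (A ^ (i + 1)) (localEst μ x y t s))
      (φ := φ) ((hinn (i + 1)).mono ((hSG _).trans le_sup_left) le_rfl) (hq.const_mul _)
      (fun z => by positivity) (fun s hs => by
        have hh : holdTime γ (k + 1) s = i + 1 := holdTime_eq (hBt s hs.1) hs.2
        have hkt : k + 1 - (i + 1) = t := by omega
        simp only [power, incInnov, hh, hkt, hφ]
        rw [← Real.exp_mul, ← Real.exp_add]
        congr 1
        field_simp
        ring)
    obtain ⟨c', hc''⟩ := exists_multivariateGaussian_withDensity hSigp (hwt (i + 1) (by omega))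
      (hSigPsi (i + 1) (by omega))
    refine ⟨c * (ENNReal.ofReal (Real.exp (-(α / (N₀ * W) * base))) * c'), ?_⟩
    rw [dropEvent_succ, ← Set.inter_assoc]
    refine hden.trans ?_
    rw [hstep, withDensity_smul_measure, mul_smul, mul_smul]
    congr 1
    refine Eq.trans ?_ (congrArg _ hc'')
    rw [← withDensity_smul _ (by fun_prop)]
    congr 1
    funext z
    rw [hφ, ENNReal.ofReal_mul (Real.exp_nonneg _)]
    rfl

end tilted

end RemoteEstimation

/-! ### Conditional moments on an event, through traces of σ-algebras. -/

namespace RemoteEstimation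

section trace

variable {Ω : Type*}

/-- The sets whose trace on `D` is the trace of a `K`-measurable set. -/
@[reducible] def traceInfo (K : MeasurableSpace Ω) (D : Set Ω) : MeasurableSpace Ω :=
  (K.comap (Subtype.val : D → Ω)).map Subtype.val

theorem exists_inter_eq_of_traceInfo {I K : MeasurableSpace Ω} {D B : Set Ω}
    (h : I ≤ traceInfo K D) (hB : MeasurableSet[I] B) :
    ∃ B', MeasurableSet[K] B' ∧ B ∩ D = B' ∩ D := by
  obtain ⟨B', hB', he⟩ := h _ hB
  refine ⟨B', hB', ?_⟩
  rw [Set.inter_comm, Set.inter_comm B']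
  exact (Subtype.preimage_val_eq_preimage_val_iff _ _ _).1 he.symm

/-- Only values on `D` matter for the trace, so `F` may be replaced by a `K`-measurable function
agreeing with it there. -/
theorem comap_le_traceInfo {β : Type*} [mβ : MeasurableSpace β] {K : MeasurableSpace Ω}
    {D : Set Ω} {F f : Ω → β} (hf : Measurable[K] f) (hF : ∀ s ∈ D, F s = f s) :
    mβ.comap F ≤ traceInfo K D := by
  rintro _ ⟨u, hu, rfl⟩
  refine ⟨f ⁻¹' u, hf hu, ?_⟩
  ext ⟨s, hs⟩
  simp [hF s hs]

variable [mΩ : MeasurableSpace Ω] {μ : Measure Ω}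

/-- The conditional expectation on an event is determined by the integrals over the trace of the
conditioning σ-algebra on it. -/
theorem condExp_eq_on_of_setIntegral_eq {Ω E : Type*} [NormedAddCommGroup E] [NormedSpace ℝ E]
    [CompleteSpace E] {I : MeasurableSpace Ω} [mΩ : MeasurableSpace Ω] {μ : Measure Ω}
    [IsFiniteMeasure μ] (hI : I ≤ mΩ) {D : Set Ω}
    (hD : MeasurableSet[I] D) {f g : Ω → E} (hf : Integrable f μ) (hg : StronglyMeasurable[I] g)
    (hgi : IntegrableOn g D μ)
    (h : ∀ B, MeasurableSet[I] B → ∫ s in B ∩ D, f s ∂μ = ∫ s in B ∩ D, g s ∂μ) :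
    ∀ᵐ s ∂μ, s ∈ D → (μ[f | I]) s = g s := by
  have hD' := hI _ hD
  have h1 : D.indicator g =ᵐ[μ] μ[D.indicator f | I] := by
    refine ae_eq_condExp_of_forall_setIntegral_eq hI (hf.indicator hD')
      (fun _ _ _ => ((integrable_indicator_iff hD').2 hgi).integrableOn) (fun B hB _ => ?_)
      (hg.indicator hD).aestronglyMeasurable
    rw [setIntegral_indicator hD', setIntegral_indicator hD', h B hB]
  filter_upwards [h1, condExp_indicator hf hD] with s hs1 hs2 hs
  rw [hs2, Set.indicator_of_mem hs, Set.indicator_of_mem hs] at hs1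
  exact hs1.symm

/-- First and second moments of a variable that is Gaussian on an event. -/
theorem setIntegral_of_map_restrict_gaussian [IsProbabilityMeasure μ] {n : ℕ}
    {S : Matrix (Fin n) (Fin n) ℝ} (hS : S.PosSemidef) {X : Ω → EuclideanSpace ℝ (Fin n)}
    (hX : Measurable X) {D : Set Ω} {c : ENNReal}
    (h : (μ.restrict D).map X = c • multivariateGaussian 0 S) :
    IntegrableOn X D μ ∧ ∫ s in D, X s ∂μ = 0 ∧
      ∀ a b, ∫ s in D, X s a * X s b ∂μ = μ.real D * S a b := by
  -- Comparing total masses, since the Gaussian is a probability measure.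
  have hc : c = μ D := by
    have := congrArg (fun ν => ν Set.univ) h
    simpa [Measure.map_apply hX MeasurableSet.univ] using this.symm
  have hct : c ≠ ⊤ := hc ▸ measure_ne_top _ _
  refine ⟨?_, ?_, fun a b => ?_⟩
  · have : Integrable id ((μ.restrict D).map X) := by
      rw [h]
      exact IsGaussian.integrable_id.smul_measure hct
    exact this.comp_measurable hX
  · rw [← integral_map (f := fun z => z) hX.aemeasurable (by fun_prop), h, integral_smul_measure,
      integral_id_multivariateGaussian, smul_zero]
  · rw [← integral_map (f := fun z : EuclideanSpace ℝ (Fin n) => z a * z b) hX.aemeasurable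
      (by fun_prop), h, integral_smul_measure, integral_mul_eval_multivariateGaussian hS, hc,
      smul_eq_mul, measureReal_def]

/-- If `X - b` is centred with covariance `S` on every trace of the conditioning σ-algebra on an
event, then `b` and `S` are the conditional mean and error covariance of `X` on this event. -/
theorem errCov_eq_on_of_setIntegral_eq {Ω : Type*} {I : MeasurableSpace Ω}
    [mΩ : MeasurableSpace Ω] {μ : Measure Ω} [IsProbabilityMeasure μ] {n : ℕ} (hI : I ≤ mΩ)
    {D : Set Ω} (hD : MeasurableSet[I] D) {X b : Ω → EuclideanSpace ℝ (Fin n)}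
    (hX : MemLp X 2 μ) (hb : Measurable[I] b) {S : Matrix (Fin n) (Fin n) ℝ}
    (h : ∀ B, MeasurableSet[I] B → IntegrableOn (fun s => X s - b s) (B ∩ D) μ ∧
      ∫ s in B ∩ D, (X s - b s) ∂μ = 0 ∧
      ∀ p q, ∫ s in B ∩ D, (X s - b s) p * (X s - b s) q ∂μ = μ.real (B ∩ D) * S p q) :
    ∀ᵐ s ∂μ, s ∈ D → errCov μ X I s = S := by
  have hXi : Integrable X μ := hX.integrable one_le_two
  have hbi : ∀ B, MeasurableSet[I] B → IntegrableOn b (B ∩ D) μ := fun B hB => by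
    have := (hXi.integrableOn (s := B ∩ D)).sub (h B hB).1
    simpa only [Pi.sub_def, sub_sub_cancel] using this
  have hm : ∀ᵐ s ∂μ, s ∈ D → (μ[X | I]) s = b s := by
    refine condExp_eq_on_of_setIntegral_eq hI hD hXi hb.stronglyMeasurable
      (by simpa using hbi _ MeasurableSet.univ) fun B hB => ?_
    have := (h B hB).2.1
    rw [integral_sub hXi.integrableOn (hbi B hB)] at this
    exact sub_eq_zero.1 this
  have hmL : MemLp (μ[X | I]) 2 μ := hX.condExp one_le_two
  -- Square integrability makes the products of error components integrable, which the conditional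
  -- covariance needs.
  have hcomp : ∀ p, MemLp (fun s => X s p - (μ[X | I]) s p) 2 μ := fun p =>
    ((EuclideanSpace.proj (𝕜 := ℝ) p).comp_memLp' hX).sub
      ((EuclideanSpace.proj (𝕜 := ℝ) p).comp_memLp' hmL)
  have hcov : ∀ p q, ∀ᵐ s ∂μ, s ∈ D → errCov μ X I s p q = S p q := by
    intro p q
    refine condExp_eq_on_of_setIntegral_eq (g := fun _ => S p q) hI hD
      ((hcomp p).integrable_mul (hcomp q)) stronglyMeasurable_const
      (integrable_const _).integrableOn fun B hB => ?_
    rw [setIntegral_const, smul_eq_mul, ← (h B hB).2.2 p q]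
    refine setIntegral_congr_ae (hI _ (hB.inter hD)) ?_
    filter_upwards [hm] with s hs hsD
    simp [hs hsD.2]
  filter_upwards [ae_all_iff.2 fun p => ae_all_iff.2 fun q => hcov p q] with s hs hsD
  ext p q
  exact hs p q hsD

end trace

/-! ### The remote estimator's error covariance. -/

section remote

variable {Ω : Type*}

theorem measurable_remoteInfo {n : ℕ} (γ : ℕ → Ω → ℕ) (xs : ℕ → Ω → EuclideanSpace ℝ (Fin n))
    {j k : ℕ} (hj : 1 ≤ j) (hjk : j ≤ k) :
    Measurable[remoteInfo γ xs k] (fun s => γ j s • xs j s) ∧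
      Measurable[remoteInfo γ xs k] (γ j) := by
  have h : sigmaGen (fun s => γ j s • xs j s) ⊔ sigmaGen (γ j) ≤ remoteInfo γ xs k :=
    le_iSup₂ (f := fun j (_ : j ∈ Finset.Icc 1 k) =>
      sigmaGen (fun s => γ j s • xs j s) ⊔ sigmaGen (γ j)) j (Finset.mem_Icc.2 ⟨hj, hjk⟩)
  exact ⟨(comap_measurable _).mono (le_sup_left.trans h) le_rfl,
    (comap_measurable _).mono (le_sup_right.trans h) le_rfl⟩

variable [mΩ : MeasurableSpace Ω] {μ : Measure Ω}

variable {n m : ℕ} {A Q Pi₀ : Matrix (Fin n) (Fin n) ℝ}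
    {C : Matrix (Fin m) (Fin n) ℝ} {R : Matrix (Fin m) (Fin m) ℝ}
    {x w : ℕ → Ω → EuclideanSpace ℝ (Fin n)} {y v : ℕ → Ω → EuclideanSpace ℝ (Fin m)}
    {Pbar : Matrix (Fin n) (Fin n) ℝ} {N₀ W α base : ℝ} {wt : ℕ → Matrix (Fin n) (Fin n) ℝ}
    {γ : ℕ → Ω → ℕ}

theorem IsSteadyPlant.memLp_state (h : IsSteadyPlant μ A Q Pi₀ C R x w y v Pbar) (k : ℕ) :
    MemLp (x k) 2 μ := by
  have hl : ∀ (X : Ω → EuclideanSpace ℝ (Fin n)) (S : Matrix (Fin n) (Fin n) ℝ),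
      HasLaw X (multivariateGaussian 0 S) μ → MemLp X 2 μ := fun X S hX => by
    have := IsGaussian.memLp_two_id (μ := multivariateGaussian (0 : EuclideanSpace ℝ (Fin n)) S)
    rw [← hX.map_eq] at this
    exact this.comp_of_map hX.aemeasurable
  induction k with
  | zero => exact hl _ _ h.law_init
  | succ k ih =>
    rw [funext (h.state_eq k)]
    exact ((LinearMap.toContinuousLinearMap (Matrix.toEuclideanLin A)).comp_memLp' ih).add
      (hl _ _ (h.law_w k))

/-- The remote error covariance on the event that the last packet arrived at time `t` and the next
`i` ones are dropped. -/
theorem errCov_remoteInfo_of_dropEvent [IsProbabilityMeasure μ]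
    (h : IsSteadyPlant μ A Q Pi₀ C R x w y v Pbar)
    (hc : IsEventChannel μ N₀ W α base wt A (x 0) w v (localEst μ x y) γ)
    (hN₀ : 0 < N₀) (hW : 0 < W) (hα : 0 < α) (hwt : ∀ τ, 1 ≤ τ → (wt τ).PosSemidef)
    (hSigPsi : ∀ τ, 1 ≤ τ → (Sig A Q Pbar wt τ - Psi A Q Pbar wt τ).PosSemidef) (t i : ℕ) :
    ∀ᵐ s ∂μ, γ t s = 1 → s ∈ dropEvent γ t i →
      errCov μ (x (t + i)) (remoteInfo γ (localEst μ x y) (t + i)) s =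
        Pbar + Psi A Q Pbar wt i := by
  obtain ⟨hP, he, hind, hS1, -, -⟩ := h.filter_error (t + i)
  have hPsi := posSemidef_Psi hS1 hwt i
  have hPPsi := hPsi.add hP
  have hest : ∀ k l, k ≤ l → Measurable[sensorInfo y l] (localEst μ x y k) := fun k l hkl =>
    (IsSteadyPlant.measurable_localEst k).mono (sensorInfo_mono y hkl) le_rfl
  have hK : ∀ k, sensorInfo y k ⊔ channelInfo γ k ≤ mΩ := fun k =>
    sup_le (h.sensorInfo_le k) (hc.channelInfo_le k)
  have hmul : ∀ j l, j ≤ l → Measurable[sensorInfo y l ⊔ channelInfo γ l]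
      (fun s => γ j s • localEst μ x y j s) := fun j l hjl =>
    @measurable_comp_nat Ω _ (sensorInfo y l ⊔ channelInfo γ l) _ _
      ((hc.measurable_indicator hjl).mono le_sup_right le_rfl)
      (fun t s => t • localEst μ x y j s)
      fun t => ((hest j l hjl).mono le_sup_left le_rfl).const_smul t
  set D : Set Ω := {s | γ t s = 1} ∩ dropEvent γ t i with hDdef
  have hIK : remoteInfo γ (localEst μ x y) (t + i) ≤
      sensorInfo y (t + i) ⊔ channelInfo γ (t + i) :=
    iSup₂_le fun j hj => sup_le (hmul j _ (Finset.mem_Icc.1 hj).2).comap_le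
      ((hc.measurable_indicator (Finset.mem_Icc.1 hj).2).mono le_sup_right le_rfl).comap_le
  have hI : remoteInfo γ (localEst μ x y) (t + i) ≤ mΩ := hIK.trans (hK _)
  have hγI : ∀ j, j ≤ t + i →
      Measurable[remoteInfo γ (localEst μ x y) (t + i)] (γ j) := fun j hj => by
    rcases Nat.eq_zero_or_pos j with rfl | hj0
    · rw [funext hc.init]
      exact measurable_const
    · exact (measurable_remoteInfo γ _ hj0 hj).2
  have hsmulI : Measurable[remoteInfo γ (localEst μ x y) (t + i)]
      (fun s => γ t s • localEst μ x y t s) := by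
    -- The generators of the remote information start at index `1`; for `t = 0` the estimate is
    -- measurable for the trivial σ-algebra.
    rcases Nat.eq_zero_or_pos t with rfl | ht
    · have : sensorInfo y 0 = ⊥ := by simp [sensorInfo]
      have h0 := hest 0 0 le_rfl
      rw [this] at h0
      simp only [hc.init, one_smul]
      exact h0.mono bot_le le_rfl
    · exact (measurable_remoteInfo γ _ ht (by omega)).1
  have hDI : MeasurableSet[remoteInfo γ (localEst μ x y) (t + i)] D := by
    have : D = γ t ⁻¹' {1} ∩ ⋂ j ∈ Set.Ioc t (t + i), γ j ⁻¹' {0} := by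
      ext s
      simp [hDdef, dropEvent]
    rw [this]
    exact (hγI t (by omega) (measurableSet_singleton 1)).inter
      (MeasurableSet.biInter (Set.to_countable _) fun j hj =>
        hγI j hj.2 (measurableSet_singleton 0))
  -- On `D` every generator after time `t` is zero, and the earlier ones are already known at time
  -- `t`.
  have htr : remoteInfo γ (localEst μ x y) (t + i) ≤
      traceInfo (sensorInfo y t ⊔ channelInfo γ t) D := by
    refine iSup₂_le fun j hj => ?_
    rcases Nat.lt_or_ge t j with hlt | hge
    · have h0 : ∀ s ∈ D, γ j s = 0 := fun s hs => hs.2 j hlt (Finset.mem_Icc.1 hj).2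
      exact sup_le (comap_le_traceInfo (f := fun _ => 0) measurable_const
          fun s hs => by rw [h0 s hs, zero_smul])
        (comap_le_traceInfo (f := fun _ => 0) measurable_const h0)
    · exact sup_le (comap_le_traceInfo (hmul j t hge) fun _ _ => rfl)
        (comap_le_traceInfo ((hc.measurable_indicator hge).mono le_sup_right le_rfl)
          fun _ _ => rfl)
  -- The factor `γ t s` makes `b` measurable for the remote information on all of `Ω`; on `D` it
  -- equals `1` and `b` is the prediction `A^i x̂ˢ_t`.
  set b : Ω → EuclideanSpace ℝ (Fin n) := fun s =>
    Matrix.toEuclideanLin (A ^ i) (γ t s • localEst μ x y t s) with hb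
  have hbI : Measurable[remoteInfo γ (localEst μ x y) (t + i)] b :=
    (measurable_toEuclideanLin _).comp hsmulI
  have hindK : Indep (sensorInfo y (t + i) ⊔ channelInfo γ (t + i))
      (sigmaGen (x (t + i) - localEst μ x y (t + i))) μ :=
    indep_sup_of_condExp_eq (h.sensorInfo_le _) (hc.channelInfo_le _)
      (((h.measurable_state_hist _).sub ((hest _ _ le_rfl).mono (h.sensorInfo_le_hist _)
        le_rfl)).comap_le.trans (histInfo_le_plantInfo _ _ _ _)) h.plantInfo_le
      (hc.condExp_sensorInfo_sup_channelInfo h _) hind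
  have hem : Measurable (x (t + i) - localEst μ x y (t + i)) :=
    (h.measurable_state _).sub ((hest _ _ le_rfl).mono (h.sensorInfo_le _) le_rfl)
  have hxb : Measurable (fun s => x (t + i) s - b s) :=
    (h.measurable_state _).sub (hbI.mono hI le_rfl)
  have hmom : ∀ B, MeasurableSet[remoteInfo γ (localEst μ x y) (t + i)] B →
      IntegrableOn (fun s => x (t + i) s - b s) (B ∩ D) μ ∧
      ∫ s in B ∩ D, (x (t + i) s - b s) ∂μ = 0 ∧
      ∀ p q, ∫ s in B ∩ D, (x (t + i) s - b s) p * (x (t + i) s - b s) q ∂μ =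
        μ.real (B ∩ D) * (Psi A Q Pbar wt i + Pbar) p q := by
    intro B hB
    obtain ⟨B', hB', heq⟩ := exists_inter_eq_of_traceInfo htr hB
    have hB1 : MeasurableSet[sensorInfo y t ⊔ channelInfo γ t] (B' ∩ {s | γ t s = 1}) :=
      hB'.inter ((hc.measurable_indicator le_rfl).mono le_sup_right le_rfl
        (measurableSet_singleton 1))
    have hBD : B ∩ D = B' ∩ {s | γ t s = 1} ∩ dropEvent γ t i := by
      rw [heq, hDdef, Set.inter_assoc]
    have hBDI : MeasurableSet[remoteInfo γ (localEst μ x y) (t + i)] (B ∩ D) := hB.inter hDI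
    obtain ⟨c, hc'⟩ := exists_map_restrict_innovation h hc hN₀ hW hα hwt hSigPsi hB1
      (fun s hs => hs.2) i
    rw [← hBD] at hc'
    -- Adding the local filtering error, independent of measurements and channel, to the accumulated
    -- innovation gives covariance `Ψ_i + P̄`.
    have hadd := map_restrict_gaussian_add hPsi hP (hK _) (hIK _ hBDI)
      (((hest (t + i) (t + i) le_rfl).sub ((measurable_toEuclideanLin (A ^ i)).comp
        (hest t (t + i) (by omega)))).mono le_sup_left le_rfl) hem hindK hc' he 1
    rw [Matrix.one_mul, Matrix.transpose_one, Matrix.mul_one] at hadd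
    refine setIntegral_of_map_restrict_gaussian hPPsi hxb (Eq.trans ?_ hadd)
    refine Measure.map_congr (ae_restrict_of_forall_mem (hI _ hBDI) fun s hs => ?_)
    have h1 : γ t s = 1 := hs.2.1
    simp only [hb, h1, one_smul, Pi.sub_apply, Function.comp_apply]
    ext p
    simp
  filter_upwards [errCov_eq_on_of_setIntegral_eq hI hDI (h.memLp_state _) hbI hmom] with s hs h1 h2
  rw [hs ⟨h1, h2⟩, add_comm]

end remote

end RemoteEstimation

/-! ### Partition according to the last arrival. -/

theorem mainTheorem2 {Ω : Type*} [MeasurableSpace Ω] (μ : Measure Ω) [IsProbabilityMeasure μ]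
    {n m : ℕ}
    -- the plant `x_{k+1} = A x_k + w_k`, `y_k = C x_k + v_k`
    (A Q Pi₀ : Matrix (Fin n) (Fin n) ℝ) (C : Matrix (Fin m) (Fin n) ℝ)
    (R : Matrix (Fin m) (Fin m) ℝ)
    (hQ : Q.PosSemidef) (hR : R.PosDef) (hPi₀ : Pi₀.PosSemidef)
    (x w : ℕ → Ω → EuclideanSpace ℝ (Fin n)) (y v : ℕ → Ω → EuclideanSpace ℝ (Fin m))
    (hx : ∀ k s, x (k + 1) s = Matrix.toEuclideanLin A (x k s) + w k s)
    (hy : ∀ k s, y k s = Matrix.toEuclideanLin C (x k s) + v k s)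
    -- zero-mean Gaussian initial state and noises, mutually independent
    (hx0_meas : Measurable (x 0)) (hw_meas : ∀ k, Measurable (w k))
    (hv_meas : ∀ k, Measurable (v k))
    (hx0 : HasLaw (x 0) (multivariateGaussian 0 Pi₀) μ)
    (hw : ∀ k, HasLaw (w k) (multivariateGaussian 0 Q) μ)
    (hv : ∀ k, HasLaw (v k) (multivariateGaussian 0 R) μ)
    (hw_indep : iIndepFun w μ) (hv_indep : iIndepFun v μ)
    (hwv_indep : IndepFun (fun s k => w k s) (fun s k => v k s) μ)
    (hx0_indep : IndepFun (x 0) (fun s => ((fun k => w k s), (fun k => v k s))) μ)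
    -- the local Kalman filter is in steady state: `P_k^s = P̄` for all `k`
    (Pbar : Matrix (Fin n) (Fin n) ℝ)
    (hsteady : ∀ k, ∀ᵐ s ∂μ,
      RemoteEstimation.errCov μ (x k) (RemoteEstimation.sensorInfo y k) s = Pbar)
    -- the controller: weights `𝒬_τ` and constant term `ω`
    (N₀ W α base : ℝ) (hN₀ : 0 < N₀) (hW : 0 < W) (hα : 0 < α) (hα1 : α ≤ 1) (hbase : 0 ≤ base)
    (wt : ℕ → Matrix (Fin n) (Fin n) ℝ) (hwt : ∀ τ, 1 ≤ τ → (wt τ).PosSemidef)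
    (hSigPsi : ∀ τ, 1 ≤ τ →
      (RemoteEstimation.Sig A Q Pbar wt τ - RemoteEstimation.Psi A Q Pbar wt τ).PosSemidef)
    -- the channel: given the plant and the past of the channel, the packet sent at time `k` is
    -- dropped with probability `q ^ ω_k`, where `q = exp (-α / (N₀ W))`
    (γ : ℕ → Ω → ℕ) (hγ_meas : ∀ k, Measurable (γ k))
    (hγ : ∀ k s, γ k s = 0 ∨ γ k s = 1) (hγ0 : ∀ s, γ 0 s = 1)
    (hchannel : ∀ k, 1 ≤ k →
      μ[Set.indicator {s | γ k s = 0} (fun _ => (1 : ℝ)) |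
          RemoteEstimation.plantAndPast (x 0) w v γ k]
        =ᵐ[μ] fun s => Real.exp (-α / (N₀ * W)) ^
          RemoteEstimation.power N₀ W α base wt A γ (RemoteEstimation.localEst μ x y) k s) :
    ∀ k, 1 ≤ k → ∀ᵐ s ∂μ,
      (γ k s = 1 →
        RemoteEstimation.errCov μ (x k)
          (RemoteEstimation.remoteInfo γ (RemoteEstimation.localEst μ x y) k) s = Pbar) ∧
      (γ k s = 0 →
        RemoteEstimation.errCov μ (x k)
          (RemoteEstimation.remoteInfo γ (RemoteEstimation.localEst μ x y) k) s
          = Pbar + RemoteEstimation.Psi A Q Pbar wt (RemoteEstimation.holdTime γ k s)) := by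
  have h : RemoteEstimation.IsSteadyPlant μ A Q Pi₀ C R x w y v Pbar :=
    ⟨hQ, hR, hPi₀, hx, hy, hx0_meas, hw_meas, hv_meas, hx0, hw, hv, hw_indep, hv_indep, hwv_indep,
      hx0_indep, hsteady⟩
  have hc : RemoteEstimation.IsEventChannel μ N₀ W α base wt A (x 0) w v
      (RemoteEstimation.localEst μ x y) γ := ⟨hγ_meas, hγ, hγ0, hchannel⟩
  have key := RemoteEstimation.errCov_remoteInfo_of_dropEvent h hc hN₀ hW hα hwt hSigPsi
  intro k hk
  -- The last arrival time is random, so the countably many exceptional null sets are discarded at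
  -- once; indices `i > k` are harmless.
  filter_upwards [key k 0, ae_all_iff.2 fun i => key (k - i) i] with s hs0 hs
  refine ⟨fun h1 => ?_, fun h0 => ?_⟩
  · have := hs0 h1 fun j hj hj' => by omega
    simpa only [add_zero, RemoteEstimation.Psi] using this
  -- The last arrival before `k`, which exists because `γ_0 = 1`; then `t + 1, …, k` is a run of `k
  -- - t = τ(k)` drops.
  · set t := Nat.findGreatest (fun t => γ t s = 1) (k - 1) with ht
    have htk : t ≤ k - 1 := Nat.findGreatest_le _
    have hτ : RemoteEstimation.holdTime γ k s = k - t := rfl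
    have h1 : γ t s = 1 := Nat.findGreatest_spec (P := fun t => γ t s = 1) (Nat.zero_le _) (hγ0 s)
    have := hs (k - t)
    rw [Nat.sub_sub_self (by omega), show t + (k - t) = k by omega] at this
    rw [hτ]
    refine this h1 fun j hj hj' => ?_
    rcases Nat.lt_or_ge j k with hlt | hge
    · exact (hγ j s).resolve_right
        (Nat.findGreatest_is_greatest (P := fun t => γ t s = 1) hj (by omega))
    · obtain rfl : j = k := by omega
      exact h0
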